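/- Conventions. For Borel probability measures $\mu,\nu$ on a separable metric space $(S,c)$, let $W(\mu,\nu)=\inf_\gamma\int c(x,y)\,d\gamma(x,y)$, the infimum being over all couplings $\gamma$ of $\mu$ and $\nu$ (the Wasserstein distance of order $1$). For $A\subseteq S$ let $\mathcal N_\epsilon(A)$ be the minimal number of closed balls of diameter $\epsilon$ (radius $\epsilon/2$) that cover $A$; put $d_\epsilon(\mu,\zeta)=-\log\bigl(\inf\{\mathcal N_\epsilon(A):\mu(A)\ge 1-\zeta\}\bigr)/\log\epsilon$ and let $d_W(\mu)=\inf\{\varphi\in(2,\infty):\limsup_{\epsilon\to0^+}d_\epsilon(\mu,\epsilon^{\varphi/(\varphi-2)})\le\varphi\}$ be the upper Wasserstein dimension (with $\inf\emptyset=\infty$). (a) Let $\mu,\nu$ be Borel probability measures on a separable metric space, each with support of diameter at most $1$, and let $\sigma_\mu>d_W(\mu)$, $\sigma_\nu>d_W(\nu)$ be real numbers. Then $W(\mu,\nu)<\infty$, and there are $\lambda_\mu,\lambda_\nu\in\mathbb R$ such that for all integers $n,m\ge1$ and all $t_\mu,t_\nu>0$ the following holds. If $\hat\mu_n$ and $\hat\nu_m$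 are the empirical measures of $n$ i.i.d. samples of $\mu$ and $m$ i.i.d. samples of $\nu$, the two samples being independent of each other, then with probability at least $(1-e^{-2nt_\mu^2})(1-e^{-2mt_\nu^2})$, $$W(\mu,\nu)\le W(\hat\mu_n,\hat\nu_m)+\lambda_\mu n^{-1/\sigma_\mu}+\lambda_\nu m^{-1/\sigma_\nu}+t_\mu+t_\nu.$$ (b) Let $P_V,Q_V$ be Borel probability measures on $\mathbb R$, each with support of diameter at most $1$, with distribution functions $F_{P_V},F_{Q_V}$; suppose that $P_V$ has a Lebesgue density bounded by $L$, and let $\sigma_P>d_W(P_V)$, $\sigma_Q>d_W(Q_V)$ be real numbers. Then there are $\lambda_P,\lambda_Q\in\mathbb R$ such that for all integers $n,m\ge1$ and all $t_P,t_Q>0$ the following holds. If $\hat P_V$ and $\hat Q_V$ are the empirical measures of $n$ i.i.d. samples of $P_V$ and $m$ i.i.d. samples of $Q_V$, the two samples being independent of each other, then with probability at least $(1-e^{-2nt_P^2})(1-e^{-2mt_Q^2})$, for all thresholds $\tau\in\mathbb R$ simultaneously, the coverage gap $|F_{P_V}(\tau)-F_{Q_V}(\tau)|$ satisfies $$|F_{P_V}(\tau)-F_{Q_V}(\tau)|\le\sqrt{2L\left(W(\hat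 P_V,\hat Q_V)+\lambda_P n^{-1/\sigma_P}+\lambda_Q m^{-1/\sigma_Q}+t_P+t_Q\right)}.$$ -/

import Mathlib

open MeasureTheory ProbabilityTheory Filter Topology
open scoped ENNReal NNReal

universe u v

noncomputable section

/-- Couplings of `μ` and `ν`: measures on the product with marginals `μ` and `ν`. -/
def couplings {X : Type u} [MeasurableSpace X] (μ ν : Measure X) : Set (Measure (X × X)) :=
  {γ | γ.map Prod.fst = μ ∧ γ.map Prod.snd = ν}

/-- The Wasserstein distance of order `1`, with values in `[0, ∞]`. -/
def wassersteinDist {X : Type u} [MetricSpace X] [MeasurableSpace X] (μ ν : Measure X) : ℝ≥0∞ :=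
  ⨅ γ ∈ couplings μ ν, ∫⁻ z, edist z.1 z.2 ∂γ

/-- The empirical measure `(1 / n) ∑ i, δ_{x i}` of `n` points. -/
def empiricalMeasure {X : Type u} [MeasurableSpace X] {n : ℕ} (x : Fin n → X) : Measure X :=
  (n : ℝ≥0∞)⁻¹ • ∑ i, Measure.dirac (x i)

/-- The minimal number of closed balls of diameter `ε` (that is, of radius `ε / 2`)
needed to cover `A`. -/
def ballCoveringNumber {X : Type u} [MetricSpace X] (ε : ℝ) (A : Set X) : ℕ∞ :=
  Metric.externalCoveringNumber (Real.toNNReal (ε / 2)) A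

/-- The minimal covering number of a set of `μ`-mass at least `1 - ζ`. -/
def massCoveringNumber {X : Type u} [MetricSpace X] [MeasurableSpace X]
    (μ : Measure X) (ε ζ : ℝ) : ℕ∞ :=
  ⨅ (A : Set X) (_ : MeasurableSet A) (_ : 1 - ENNReal.ofReal ζ ≤ μ A), ballCoveringNumber ε A

/-- The `(ε, ζ)`-dimension `- log N / log ε`, where `N` is `massCoveringNumber μ ε ζ`. -/
def epsDimension {X : Type u} [MetricSpace X] [MeasurableSpace X]
    (μ : Measure X) (ε ζ : ℝ) : EReal :=
  -(ENNReal.log (massCoveringNumber μ ε ζ : ℝ≥0∞)) / ((Real.log ε : ℝ) : EReal)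

/-- The upper Wasserstein dimension for order `1`; it is `⊤` if no exponent is admissible. -/
def upperWassersteinDim {X : Type u} [MetricSpace X] [MeasurableSpace X]
    (μ : Measure X) : EReal :=
  sInf ((fun φ : ℝ => (φ : EReal)) ''
    {φ : ℝ | 2 < φ ∧
      limsup (fun ε : ℝ => epsDimension μ ε (ε ^ (φ / (φ - 2)))) (𝓝[>] (0 : ℝ)) ≤ (φ : EReal)})

/-- `X 0, …, X (n-1)` are independent random variables with common law `μ`. -/
def IsIIDSample {Ω : Type v} [MeasurableSpace Ω] {S : Type u} [MeasurableSpace S]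
    (P : Measure Ω) (μ : Measure S) {n : ℕ} (X : Fin n → Ω → S) : Prop :=
  (∀ i, Measurable (X i)) ∧ (∀ i, P.map (X i) = μ) ∧ iIndepFun X P

/-- An i.i.d. sample of `μ` and an i.i.d. sample of `ν`, independent of each other. -/
def AreIndepIIDSamples {Ω : Type v} [MeasurableSpace Ω] {S : Type u} [MeasurableSpace S]
    (P : Measure Ω) (μ ν : Measure S) {n m : ℕ} (X : Fin n → Ω → S) (Y : Fin m → Ω → S) : Prop :=
  IsIIDSample P μ X ∧ IsIIDSample P ν Y ∧
    IndepFun (fun ω i => X i ω) (fun ω j => Y j ω) P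

/-- `μ` has a density with respect to Lebesgue measure that is bounded by `L`. -/
def HasLebesgueDensityBoundedBy (μ : Measure ℝ) (L : ℝ) : Prop :=
  ∃ f : ℝ → ℝ≥0∞, Measurable f ∧ (∀ᵐ x, f x ≤ ENNReal.ofReal L) ∧ μ = volume.withDensity f

/-- The coverage gap at the threshold `τ`: the distance between the distribution functions. -/
def coverageGap (P Q : Measure ℝ) (τ : ℝ) : ℝ := |cdf P τ - cdf Q τ|

end

/-! Pass from `μ` to its empirical measure, then to that of `ν`, then to `ν`. The triangle
inequality (`wassersteinDist_triangle`) needs only finitely supported middle measures, so gluing is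
a finite sum over atoms. Each outer term concentrates around its mean: replacing one sample point
moves it by at most `1 / n`, so McDiarmid gives the tail `exp (-2 n t ^ 2)`. Independence of the two
samples multiplies the probabilities.

The mean is bounded by transport along nested partitions. Inside each cell of the finest one, as
much mass as possible is matched; the unmatched mass is handed to the next coarser partition, whose
excesses are unaffected by what has been matched (`wassersteinDist_le_multiscale`). A partition into
`N` cells has mean excess at most `√(N / n)`, by the variance of empirical frequencies and
Cauchy–Schwarz.

Pick `s` with `d_W < s < σ` and scales `n ^ (-a k)`, with `a k` falling from `1 / s` to `(s - 2) / s
^ 2` in `K` equal steps `η`. The finest scale costs `n ^ (-1 / s)`. At the coarsest, `N ≤ n ^ (1 - 2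
/ s)`, so the mass left over is at most `n ^ (-1 / s)` on average and may travel distance `1`; the
uncovered mass there has the same order, which is the role of the exponent `s / (s - 2)`. Each
intermediate step costs at most `n ^ (η - 1 / s)` up to a constant, and the loss `n ^ η` is absorbed
by `s < σ` once `K` is large. As `K` does not depend on `n`, no logarithm appears.

For the coverage gap, a coupling must carry mass at least `a = |F_P(τ) - F_Q(τ)|` across `τ`. A
density at most `L` allows little of it to start near `τ`, so `h * a ≤ W + L * h ^ 2 / 2` for all `h
> 0`; take `h = a / L`. This is deterministic, so one event serves all `τ`. -/

/-! ### Couplings of finite measures and rescaling on cells -/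

section Cells

variable {X : Type u} [MeasurableSpace X]

lemma add_mem_couplings {μ ν μ' ν' : Measure X} {γ γ' : Measure (X × X)}
    (hγ : γ ∈ couplings μ ν) (hγ' : γ' ∈ couplings μ' ν') :
    γ + γ' ∈ couplings (μ + μ') (ν + ν') := by
  refine ⟨?_, ?_⟩
  · rw [Measure.map_add _ _ measurable_fst, hγ.1, hγ'.1]
  · rw [Measure.map_add _ _ measurable_snd, hγ.2, hγ'.2]

lemma smul_prod_mem_couplings {p q : Measure X} [IsFiniteMeasure p] [IsFiniteMeasure q]
    (hpq : p Set.univ = q Set.univ) : (p Set.univ)⁻¹ • p.prod q ∈ couplings p q := by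
  by_cases h0 : p Set.univ = 0
  · have hp : p = 0 := Measure.measure_univ_eq_zero.1 h0
    have hq : q = 0 := Measure.measure_univ_eq_zero.1 (hpq ▸ h0)
    simp [couplings, hp, hq]
  · have h1 := ENNReal.inv_mul_cancel h0 (measure_ne_top p Set.univ)
    refine ⟨?_, ?_⟩
    · rw [Measure.map_smul, Measure.map_fst_prod, smul_smul, ← hpq, h1, one_smul]
    · rw [Measure.map_smul, Measure.map_snd_prod, smul_smul, h1, one_smul]

/-- The part of the mass of `p` that a coupling with `q` has to move between cells of `π`. -/
noncomputable def cellExcess (π : X → ℕ) (N : ℕ) (p q : Measure X) : ℝ≥0∞ :=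
  ∑ i ∈ Finset.range N, (p (π ⁻¹' {i}) - q (π ⁻¹' {i}))

/-- The measure `p`, rescaled by `c i` on the `i`-th cell of `π`. -/
noncomputable def cellRescale (π : X → ℕ) (N : ℕ) (c : ℕ → ℝ≥0∞) (p : Measure X) : Measure X :=
  ∑ i ∈ Finset.range N, c i • p.restrict (π ⁻¹' {i})

lemma cellRescale_one {π : X → ℕ} (hπ : Measurable π) {N : ℕ} (hN : ∀ x, π x < N)
    (p : Measure X) : cellRescale π N (fun _ => 1) p = p := by
  ext s hs
  simp only [cellRescale, one_smul, Measure.coe_finsetSum, Finset.sum_apply,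
    Measure.restrict_apply hs]
  rw [← measure_biUnion_finset]
  · congr 1
    ext x
    simp only [Set.mem_iUnion, Finset.mem_range, Set.mem_inter_iff, Set.mem_preimage,
      Set.mem_singleton_iff]
    exact ⟨fun ⟨_, _, h, _⟩ => h, fun h => ⟨π x, hN x, h, rfl⟩⟩
  · intro i _ j _ hij
    refine Set.disjoint_left.2 fun x hx hx' => hij ?_
    exact (hx.2 : π x = i).symm.trans hx'.2
  · exact fun i _ => hs.inter (hπ (measurableSet_singleton i))

lemma cellRescale_add (π : X → ℕ) (N : ℕ) (c c' : ℕ → ℝ≥0∞) (p : Measure X) :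
    cellRescale π N c p + cellRescale π N c' p = cellRescale π N (c + c') p := by
  simp only [cellRescale, ← Finset.sum_add_distrib, Pi.add_apply, add_smul]

lemma cellRescale_congr {π : X → ℕ} {N : ℕ} {c c' : ℕ → ℝ≥0∞} {p : Measure X}
    (h : ∀ i, p (π ⁻¹' {i}) ≠ 0 → c i = c' i) : cellRescale π N c p = cellRescale π N c' p := by
  refine Finset.sum_congr rfl fun i _ => ?_
  by_cases hi : p (π ⁻¹' {i}) = 0
  · rw [Measure.restrict_eq_zero.2 hi, smul_zero, smul_zero]
  · rw [h i hi]

lemma cellRescale_apply_comp {π : X → ℕ} (hπ : Measurable π) (N : ℕ) (c : ℕ → ℝ≥0∞)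
    (p : Measure X) (s : Set ℕ) [DecidablePred (· ∈ s)] :
    cellRescale π N c p (π ⁻¹' s) =
      ∑ i ∈ Finset.range N, if i ∈ s then c i * p (π ⁻¹' {i}) else 0 := by
  simp only [cellRescale, Measure.coe_finsetSum, Finset.sum_apply, Measure.smul_apply,
    smul_eq_mul]
  refine Finset.sum_congr rfl fun i _ => ?_
  rw [Measure.restrict_apply (hπ (Set.to_countable s).measurableSet), ← Set.preimage_inter]
  split_ifs with h
  · rw [Set.inter_eq_self_of_subset_right (Set.singleton_subset_iff.2 h)]
  · rw [Set.inter_singleton_eq_empty.2 h]; simp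

lemma cellRescale_univ {π : X → ℕ} (hπ : Measurable π) (N : ℕ) (c : ℕ → ℝ≥0∞)
    (p : Measure X) :
    cellRescale π N c p Set.univ = ∑ i ∈ Finset.range N, c i * p (π ⁻¹' {i}) := by
  classical
  simpa using cellRescale_apply_comp hπ N c p Set.univ

/-- Cells of a coarser partition are unions of cells of `π`, where the matched parts `p₀` and `q₀`
cancel. This lets the multiscale induction measure every excess with the original pair. -/
lemma cellExcess_add_of_forall_eq {p₀ q₀ p₁ q₁ : Measure X} [IsFiniteMeasure q₀] {π : X → ℕ}
    (h : ∀ s : Set ℕ, p₀ (π ⁻¹' s) = q₀ (π ⁻¹' s)) (τ : ℕ → ℕ) (N : ℕ) :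
    cellExcess (τ ∘ π) N (p₀ + p₁) (q₀ + q₁) = cellExcess (τ ∘ π) N p₁ q₁ := by
  refine Finset.sum_congr rfl fun i _ => ?_
  rw [Measure.add_apply, Measure.add_apply, Set.preimage_comp, h,
    ENNReal.add_sub_add_eq_sub_left (measure_ne_top _ _)]

end Cells

/-! ### Deterministic multiscale bound -/

section Transport

variable {X : Type u} [MetricSpace X] [MeasurableSpace X]

lemma wassersteinDist_le_lintegral {μ ν : Measure X} {γ : Measure (X × X)}
    (hγ : γ ∈ couplings μ ν) : wassersteinDist μ ν ≤ ∫⁻ z, edist z.1 z.2 ∂γ :=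
  iInf₂_le γ hγ

lemma wassersteinDist_add_le (μ ν μ' ν' : Measure X) :
    wassersteinDist (μ + μ') (ν + ν') ≤ wassersteinDist μ ν + wassersteinDist μ' ν' := by
  refine ENNReal.le_iInf₂_add_iInf₂ fun γ hγ γ' hγ' => ?_
  refine (wassersteinDist_le_lintegral (add_mem_couplings hγ hγ')).trans ?_
  rw [lintegral_add_measure]

/-- The penalty `b` depends on one point at a time, so it is paid through the marginals whatever the
coupling. It later absorbs uncovered points and points off the support. -/
lemma wassersteinDist_le_of_ae {μ ν : Measure X} {γ : Measure (X × X)}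
    (hγ : γ ∈ couplings μ ν) {r : ℝ≥0∞} {b : X → ℝ≥0∞} (hb : Measurable b)
    (h : ∀ᵐ z ∂γ, edist z.1 z.2 ≤ r + b z.1 + b z.2) :
    wassersteinDist μ ν ≤ r * μ Set.univ + ∫⁻ x, b x ∂μ + ∫⁻ x, b x ∂ν := by
  refine (wassersteinDist_le_lintegral hγ).trans ((lintegral_mono_ae h).trans ?_)
  rw [lintegral_add_right (μ := γ) (fun z => r + b z.1) (g := fun z => b z.2)
      (hb.comp measurable_snd),
    lintegral_add_left measurable_const, lintegral_const, ← hγ.1, ← hγ.2, lintegral_map hb measurable_fst,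
    lintegral_map hb measurable_snd, Measure.map_apply measurable_fst MeasurableSet.univ]
  simp

lemma wassersteinDist_le_of_forall {p q : Measure X} [IsFiniteMeasure p] [IsFiniteMeasure q]
    (hpq : p Set.univ = q Set.univ) {r : ℝ≥0∞} {b : X → ℝ≥0∞} (hb : Measurable b)
    (hr : ∀ x y, edist x y ≤ r + b x + b y) :
    wassersteinDist p q ≤ r * p Set.univ + ∫⁻ x, b x ∂p + ∫⁻ x, b x ∂q :=
  wassersteinDist_le_of_ae (smul_prod_mem_couplings hpq) hb (ae_of_all _ fun _ => hr _ _)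

/-- Couple as much mass as possible inside the cells of `π`; the remainders carry
exactly the excess of `π`, and coarser partitions do not see the coupled part. -/
lemma exists_cellwise_decomposition {p q : Measure X} [IsFiniteMeasure p] [IsFiniteMeasure q]
    (hpq : p Set.univ = q Set.univ) {π : X → ℕ} (hπ : Measurable π) {N : ℕ}
    (hN : ∀ x, π x < N) {r : ℝ≥0∞} {b : X → ℝ≥0∞} (hb : Measurable b)
    (hr : ∀ x y, π x = π y → edist x y ≤ r + b x + b y) :
    ∃ p₀ q₀ p₁ q₁ : Measure X, p = p₀ + p₁ ∧ q = q₀ + q₁ ∧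
      p₁ Set.univ = q₁ Set.univ ∧ p₁ Set.univ = cellExcess π N p q ∧
      (∀ s : Set ℕ, p₀ (π ⁻¹' s) = q₀ (π ⁻¹' s)) ∧
      wassersteinDist p₀ q₀ ≤ r * p₀ Set.univ + ∫⁻ x, b x ∂p₀ + ∫⁻ x, b x ∂q₀ := by
  classical
  -- On each cell `min p q + (p - q) = p` with truncated subtraction: the first summand is matched,
  -- the second is left over.
  have key : ∀ (p q : Measure X) [IsFiniteMeasure p] [IsFiniteMeasure q],
      p = cellRescale π N (fun i => min (p (π ⁻¹' {i})) (q (π ⁻¹' {i})) / p (π ⁻¹' {i})) p +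
        cellRescale π N (fun i => (p (π ⁻¹' {i}) - q (π ⁻¹' {i})) / p (π ⁻¹' {i})) p := by
    intro p q _ _
    rw [cellRescale_add]
    conv_lhs => rw [← cellRescale_one hπ hN p]
    refine cellRescale_congr fun i hi => ?_
    simp only [Pi.add_apply]
    rw [← ENNReal.add_div, add_comm, tsub_add_min, ENNReal.div_self hi (measure_ne_top _ _)]
  have hc : ∀ (p : Measure X) [IsFiniteMeasure p] (a : ℝ≥0∞) (i : ℕ), a ≤ p (π ⁻¹' {i}) →
      a / p (π ⁻¹' {i}) * p (π ⁻¹' {i}) = a := by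
    intro p _ a i ha
    by_cases h0 : p (π ⁻¹' {i}) = 0
    · rw [h0] at ha ⊢
      simp [nonpos_iff_eq_zero.1 ha]
    · exact ENNReal.div_mul_cancel h0 (measure_ne_top _ _)
  have hmul : ∀ a d m : ℝ≥0∞, d ≠ 0 → d ≠ ⊤ → m / (a * d) * d = m / a := by
    intro a d m h0 h1
    rw [← ENNReal.mul_div_right_comm, ENNReal.mul_div_mul_right _ _ h0 h1]
  set cp : ℕ → ℝ≥0∞ := fun i => min (p (π ⁻¹' {i})) (q (π ⁻¹' {i})) / p (π ⁻¹' {i}) with hcp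
  set cq : ℕ → ℝ≥0∞ := fun i => min (q (π ⁻¹' {i})) (p (π ⁻¹' {i})) / q (π ⁻¹' {i}) with hcq
  set p₁ := cellRescale π N (fun i => (p (π ⁻¹' {i}) - q (π ⁻¹' {i})) / p (π ⁻¹' {i})) p
  set q₁ := cellRescale π N (fun i => (q (π ⁻¹' {i}) - p (π ⁻¹' {i})) / q (π ⁻¹' {i})) q
  have hp := key p q
  have hq := key q p
  have heq : ∀ s : Set ℕ, cellRescale π N cp p (π ⁻¹' s) = cellRescale π N cq q (π ⁻¹' s) := by
    intro s
    rw [cellRescale_apply_comp hπ, cellRescale_apply_comp hπ]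
    refine Finset.sum_congr rfl fun i _ => ?_
    simp only [hcp, hcq]
    rw [hc p _ i (min_le_left _ _), hc q _ i (min_le_left _ _), min_comm]
  have huniv : cellRescale π N cp p Set.univ = cellRescale π N cq q Set.univ := by
    simpa using heq Set.univ
  refine ⟨cellRescale π N cp p, cellRescale π N cq q, p₁, q₁, hp, hq, ?_, ?_, heq, ?_⟩
  · have h1 : p Set.univ = cellRescale π N cp p Set.univ + p₁ Set.univ := by
      conv_lhs => rw [hp]
      rfl
    have h2 : q Set.univ = cellRescale π N cq q Set.univ + q₁ Set.univ := by
      conv_lhs => rw [hq]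
      rfl
    have hfin : cellRescale π N cp p Set.univ ≠ ⊤ :=
      ne_top_of_le_ne_top (measure_ne_top p Set.univ) (h1 ▸ le_self_add)
    rw [h1, h2, ← huniv] at hpq
    exact (ENNReal.add_right_inj hfin).1 hpq
  · rw [cellRescale_univ hπ]
    exact Finset.sum_congr rfl fun i _ => hc p _ i tsub_le_self
  -- The coupling is the product measure on each cell, normalised to total mass `min p q`.
  · let c : ℕ → ℝ≥0∞ := fun i => min (p (π ⁻¹' {i})) (q (π ⁻¹' {i})) /
      (p (π ⁻¹' {i}) * q (π ⁻¹' {i}))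
    have hcell : ∀ i, MeasurableSet (π ⁻¹' {i}) := fun i => hπ (measurableSet_singleton i)
    refine wassersteinDist_le_of_ae
      (γ := ∑ i ∈ Finset.range N,
        c i • (p.restrict (π ⁻¹' {i})).prod (q.restrict (π ⁻¹' {i}))) ⟨?_, ?_⟩ hb ?_
    · rw [Measure.map_finset_sum measurable_fst.aemeasurable]
      refine Finset.sum_congr rfl fun i _ => ?_
      rw [Measure.map_smul, Measure.map_fst_prod, smul_smul, Measure.restrict_apply_univ]
      by_cases hq0 : q (π ⁻¹' {i}) = 0
      · simp [c, hcp, hq0]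
      · simp only [c, hcp]
        rw [hmul _ _ _ hq0 (measure_ne_top _ _)]
    · rw [Measure.map_finset_sum measurable_snd.aemeasurable]
      refine Finset.sum_congr rfl fun i _ => ?_
      rw [Measure.map_smul, Measure.map_snd_prod, smul_smul, Measure.restrict_apply_univ]
      by_cases hp0 : p (π ⁻¹' {i}) = 0
      · simp [c, hcq, hp0]
      · simp only [c, hcq]
        rw [mul_comm (p _), hmul _ _ _ hp0 (measure_ne_top _ _), min_comm]
    · refine ae_finsetSum_measure_iff.2 fun i _ => ?_
      refine Measure.ae_smul_measure ?_ _
      rw [Measure.prod_restrict]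
      filter_upwards [ae_restrict_mem ((hcell i).prod (hcell i))] with z hz
      exact hr _ _ (hz.1.trans hz.2.symm)

/-- The multiscale upper bound for the Wasserstein distance: `π 0` is the finest partition,
each `π (k + 1)` is coarser than `π k`, and `π K` is controlled at scale `r K`. -/
lemma wassersteinDist_le_multiscale {b : X → ℝ≥0∞} (hb : Measurable b) (K : ℕ) :
    ∀ (π : ℕ → X → ℕ) (τ : ℕ → ℕ → ℕ) (N : ℕ → ℕ) (r : ℕ → ℝ≥0∞) (p q : Measure X)
      [IsFiniteMeasure p] [IsFiniteMeasure q], p Set.univ = q Set.univ →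
      (∀ k, Measurable (π k)) → (∀ k x, π k x < N k) → (∀ k, π (k + 1) = τ k ∘ π k) →
      (∀ k ≤ K, ∀ x y, π k x = π k y → edist x y ≤ r k + b x + b y) →
      (∀ x y, edist x y ≤ r (K + 1) + b x + b y) →
      wassersteinDist p q ≤ (∫⁻ x, b x ∂p) + (∫⁻ x, b x ∂q) + r 0 * p Set.univ +
        ∑ k ∈ Finset.range (K + 1), r (k + 1) * cellExcess (π k) (N k) p q := by
  -- One level of the recursion: pay `r` for the mass matched within cells, and `R` for the
  -- remainder.
  have step : ∀ {π : X → ℕ} {N : ℕ} {r : ℝ≥0∞} {p q : Measure X} {R : Measure X → Measure X → ℝ≥0∞}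
      [IsFiniteMeasure p] [IsFiniteMeasure q], p Set.univ = q Set.univ → Measurable π →
      (∀ x, π x < N) → (∀ x y, π x = π y → edist x y ≤ r + b x + b y) →
      (∀ (p₀ q₀ p₁ q₁ : Measure X), p = p₀ + p₁ → q = q₀ + q₁ →
        p₁ Set.univ = q₁ Set.univ → p₁ Set.univ = cellExcess π N p q →
        (∀ s : Set ℕ, p₀ (π ⁻¹' s) = q₀ (π ⁻¹' s)) →
        wassersteinDist p₁ q₁ ≤ ∫⁻ x, b x ∂p₁ + ∫⁻ x, b x ∂q₁ + R p q) →
      wassersteinDist p q ≤ ∫⁻ x, b x ∂p + ∫⁻ x, b x ∂q + r * p Set.univ + R p q := by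
    intro π N r p q R _ _ hpq hπ hN hr H
    obtain ⟨p₀, q₀, p₁, q₁, hp, hq, h1, h2, h3, h4⟩ :=
      exists_cellwise_decomposition hpq hπ hN hb hr
    have h5 := H p₀ q₀ p₁ q₁ hp hq h1 h2 h3
    have hbp : ∫⁻ x, b x ∂p = ∫⁻ x, b x ∂p₀ + ∫⁻ x, b x ∂p₁ := by
      rw [hp, lintegral_add_measure]
    have hbq : ∫⁻ x, b x ∂q = ∫⁻ x, b x ∂q₀ + ∫⁻ x, b x ∂q₁ := by
      rw [hq, lintegral_add_measure]
    have hu : p₀ Set.univ ≤ p Set.univ := by rw [hp]; exact le_self_add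
    calc wassersteinDist p q ≤ wassersteinDist p₀ q₀ + wassersteinDist p₁ q₁ := by
          conv_lhs => rw [hp, hq]
          exact wassersteinDist_add_le _ _ _ _
      _ ≤ (r * p Set.univ + ∫⁻ x, b x ∂p₀ + ∫⁻ x, b x ∂q₀) +
          (∫⁻ x, b x ∂p₁ + ∫⁻ x, b x ∂q₁ + R p q) :=
          add_le_add (h4.trans (by gcongr)) h5
      _ = _ := by rw [hbp, hbq]; ring
  induction K with
  | zero =>
    intro π τ N r p q _ _ hpq hπ hN hτ hr hK
    refine step hpq (hπ 0) (hN 0) (hr 0 le_rfl)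
      (R := fun p q => ∑ k ∈ Finset.range (0 + 1), r (k + 1) * cellExcess (π k) (N k) p q)
      fun p₀ q₀ p₁ q₁ hp hq h1 h2 h3 => ?_
    have : IsFiniteMeasure p₁ := ⟨lt_of_le_of_lt (by rw [hp]; exact le_add_self) (measure_lt_top p Set.univ)⟩
    have : IsFiniteMeasure q₁ := ⟨lt_of_le_of_lt (by rw [hq]; exact le_add_self) (measure_lt_top q Set.univ)⟩
    refine (wassersteinDist_le_of_forall h1 hb hK).trans (le_of_eq ?_)
    rw [Finset.sum_range_one, h2]
    ring
  | succ K ih =>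
    intro π τ N r p q _ _ hpq hπ hN hτ hr hK
    refine step hpq (hπ 0) (hN 0) (hr 0 (Nat.zero_le _))
      (R := fun p q => ∑ k ∈ Finset.range (K + 1 + 1), r (k + 1) * cellExcess (π k) (N k) p q)
      fun p₀ q₀ p₁ q₁ hp hq h1 h2 h3 => ?_
    have : IsFiniteMeasure p₁ := ⟨lt_of_le_of_lt (by rw [hp]; exact le_add_self) (measure_lt_top p Set.univ)⟩
    have : IsFiniteMeasure q₁ := ⟨lt_of_le_of_lt (by rw [hq]; exact le_add_self) (measure_lt_top q Set.univ)⟩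
    have : IsFiniteMeasure q₀ := ⟨lt_of_le_of_lt (by rw [hq]; exact le_self_add) (measure_lt_top q Set.univ)⟩
    have := ih (fun k => π (k + 1)) (fun k => τ (k + 1)) (fun k => N (k + 1))
      (fun k => r (k + 1)) p₁ q₁ h1 (fun k => hπ _) (fun k => hN _) (fun k => hτ _)
      (fun k hk => hr (k + 1) (by omega)) hK
    refine this.trans (le_of_eq ?_)
    -- Every level factors through the finest one, so its excess is the same for the remainders as
    -- for `p` and `q`.
    have hcomp : ∀ k, ∃ σ : ℕ → ℕ, π k = σ ∘ π 0 := by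
      intro k
      induction k with
      | zero => exact ⟨id, rfl⟩
      | succ k ihk =>
        obtain ⟨σ, hσ⟩ := ihk
        exact ⟨τ k ∘ σ, by rw [hτ, hσ]; rfl⟩
    rw [Finset.sum_range_succ' _ (K + 1), h2, add_assoc]
    congr 1
    rw [add_comm]
    congr 1
    refine Finset.sum_congr rfl fun k _ => ?_
    obtain ⟨σ, hσ⟩ := hcomp (k + 1)
    rw [hp, hq, hσ, cellExcess_add_of_forall_eq h3]

end Transport

/-! ### Symmetry and triangle inequality -/

section Gluing

variable {X : Type u} [MetricSpace X] [MeasurableSpace X] [BorelSpace X]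

lemma sum_restrict_fiber {Z : Type*} [MeasurableSpace Z] {γ : Measure Z} {f : Z → X}
    (hf : Measurable f) {F : Finset X} (hF : γ.map f (F : Set X)ᶜ = 0) :
    ∑ z ∈ F, γ.restrict (f ⁻¹' {z}) = γ := by
  ext s hs
  simp only [Measure.coe_finsetSum, Finset.sum_apply, Measure.restrict_apply hs]
  rw [← measure_biUnion_finset]
  · rw [Measure.map_apply hf F.measurableSet.compl] at hF
    have : (⋃ z ∈ F, s ∩ f ⁻¹' {z}) = s ∩ f ⁻¹' F := by ext x; simp
    rw [this]
    refine measure_inter_conull ?_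
    rwa [Set.preimage_compl] at hF
  · intro i _ j _ hij
    refine Set.disjoint_left.2 fun x hx hx' => hij ?_
    exact (hx.2 : f x = i).symm.trans hx'.2
  · exact fun i _ => hs.inter (hf (measurableSet_singleton i))

lemma wassersteinDist_comm [SecondCountableTopology X] (μ ν : Measure X) :
    wassersteinDist μ ν = wassersteinDist ν μ := by
  have key : ∀ μ ν : Measure X, wassersteinDist μ ν ≤ wassersteinDist ν μ := by
    intro μ ν
    refine le_iInf₂ fun γ hγ => ?_
    refine (wassersteinDist_le_lintegral (γ := γ.map Prod.swap) ⟨?_, ?_⟩).trans (le_of_eq ?_)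
    · rw [Measure.map_map measurable_fst measurable_swap]; exact hγ.2
    · rw [Measure.map_map measurable_snd measurable_swap]; exact hγ.1
    · rw [lintegral_map measurable_edist measurable_swap]
      exact lintegral_congr fun z => edist_comm _ _
  exact le_antisymm (key _ _) (key _ _)

/-- The triangle inequality, when the measure in the middle is finitely supported. -/
lemma wassersteinDist_triangle [SecondCountableTopology X] {p q r : Measure X} [IsFiniteMeasure q]
    {F : Finset X} (hF : q (F : Set X)ᶜ = 0) :
    wassersteinDist p r ≤ wassersteinDist p q + wassersteinDist q r := by
  refine ENNReal.le_iInf₂_add_iInf₂ fun γ₁ hγ₁ γ₂ hγ₂ => ?_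
  have hs₁ := sum_restrict_fiber (γ := γ₁) measurable_snd (F := F) (by rwa [hγ₁.2])
  have hs₂ := sum_restrict_fiber (γ := γ₂) measurable_fst (F := F) (by rwa [hγ₂.1])
  -- Unnormalised conditional laws of the outer coordinates given the atom `z`; both have mass `q
  -- {z}`, so their product can be normalised without disintegration.
  let α : X → Measure X := fun z => (γ₁.restrict (Prod.snd ⁻¹' {z})).map Prod.fst
  let β : X → Measure X := fun z => (γ₂.restrict (Prod.fst ⁻¹' {z})).map Prod.snd
  have hα : ∀ z, α z Set.univ = q {z} := fun z => by
    rw [Measure.map_apply measurable_fst MeasurableSet.univ, Set.preimage_univ,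
      Measure.restrict_apply_univ, ← Measure.map_apply measurable_snd (measurableSet_singleton z),
      hγ₁.2]
  have hβ : ∀ z, β z Set.univ = q {z} := fun z => by
    rw [Measure.map_apply measurable_snd MeasurableSet.univ, Set.preimage_univ,
      Measure.restrict_apply_univ, ← Measure.map_apply measurable_fst (measurableSet_singleton z),
      hγ₂.1]
  have : ∀ z, IsFiniteMeasure (α z) := fun z => ⟨by rw [hα]; exact measure_lt_top _ _⟩
  have : ∀ z, IsFiniteMeasure (β z) := fun z => ⟨by rw [hβ]; exact measure_lt_top _ _⟩
  have hαβ : ∀ z, α z Set.univ = β z Set.univ := fun z => (hα z).trans (hβ z).symm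
  have hγ : ∑ z ∈ F, (α z Set.univ)⁻¹ • (α z).prod (β z) ∈ couplings p r := by
    refine ⟨?_, ?_⟩
    · rw [Measure.map_finset_sum measurable_fst.aemeasurable, ← hγ₁.1, ← hs₁,
        Measure.map_finset_sum measurable_fst.aemeasurable]
      exact Finset.sum_congr rfl fun z _ => (smul_prod_mem_couplings (hαβ z)).1
    · rw [Measure.map_finset_sum measurable_snd.aemeasurable, ← hγ₂.2, ← hs₂,
        Measure.map_finset_sum measurable_snd.aemeasurable]
      exact Finset.sum_congr rfl fun z _ => (smul_prod_mem_couplings (hαβ z)).2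
  refine (wassersteinDist_le_lintegral hγ).trans ?_
  conv_rhs => rw [← hs₁, ← hs₂]
  rw [lintegral_finsetSum_measure, lintegral_finsetSum_measure, lintegral_finsetSum_measure,
    ← Finset.sum_add_distrib]
  refine Finset.sum_le_sum fun z _ => ?_
  have hmeas : Measurable fun x : X => edist x z := measurable_edist_left
  have hmeas' : Measurable fun x : X => edist z x := measurable_edist_right
  have hc := smul_prod_mem_couplings (hαβ z)
  calc ∫⁻ w, edist w.1 w.2 ∂(α z Set.univ)⁻¹ • (α z).prod (β z)
      ≤ ∫⁻ w, (edist w.1 z + edist z w.2) ∂(α z Set.univ)⁻¹ • (α z).prod (β z) :=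
        lintegral_mono fun w => edist_triangle _ _ _
    _ = ∫⁻ x, edist x z ∂α z + ∫⁻ y, edist z y ∂β z := by
        have h1 := lintegral_map hmeas measurable_fst
          (μ := (α z Set.univ)⁻¹ • (α z).prod (β z))
        have h2 := lintegral_map hmeas' measurable_snd
          (μ := (α z Set.univ)⁻¹ • (α z).prod (β z))
        rw [hc.1] at h1
        rw [hc.2] at h2
        rw [h1, h2]
        exact lintegral_add_left (hmeas.comp measurable_fst) _
    _ = _ := by
        rw [lintegral_map hmeas measurable_fst, lintegral_map hmeas' measurable_snd]
        congr 1
        · refine setLIntegral_congr_fun (measurable_snd (measurableSet_singleton z)) ?_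
          intro w hw
          have : w.2 = z := hw
          simp only [this]
        · refine setLIntegral_congr_fun (measurable_fst (measurableSet_singleton z)) ?_
          intro w hw
          have : w.1 = z := hw
          simp only [this]

end Gluing

/-! ### Empirical measures -/

section Empirical

variable {X : Type u} [MeasurableSpace X]

lemma isProbabilityMeasure_empiricalMeasure {n : ℕ} (hn : 0 < n) (x : Fin n → X) :
    IsProbabilityMeasure (empiricalMeasure x) := by
  constructor
  simp only [empiricalMeasure, Measure.smul_apply, Measure.coe_finsetSum, Finset.sum_apply,
    measure_univ, Finset.sum_const, Finset.card_univ, Fintype.card_fin, smul_eq_mul,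
    nsmul_eq_mul, mul_one]
  exact ENNReal.inv_mul_cancel (by simp [hn.ne']) (by simp)

lemma lintegral_empiricalMeasure {n : ℕ} (x : Fin n → X) {f : X → ℝ≥0∞} (hf : Measurable f) :
    ∫⁻ y, f y ∂empiricalMeasure x = (n : ℝ≥0∞)⁻¹ * ∑ i, f (x i) := by
  rw [empiricalMeasure, lintegral_smul_measure, lintegral_finsetSum_measure]
  simp [lintegral_dirac' _ hf]

lemma empiricalMeasure_apply {n : ℕ} (x : Fin n → X) {s : Set X} (hs : MeasurableSet s) :
    empiricalMeasure x s = (n : ℝ≥0∞)⁻¹ * ∑ i, s.indicator 1 (x i) := by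
  simp [empiricalMeasure, Measure.dirac_apply' _ hs]

variable [MetricSpace X] [BorelSpace X]

lemma exists_finset_empiricalMeasure_compl_eq_zero {n : ℕ} (x : Fin n → X) :
    ∃ F : Finset X, empiricalMeasure x (F : Set X)ᶜ = 0 := by
  classical
  refine ⟨Finset.univ.image x, ?_⟩
  rw [empiricalMeasure_apply x (Finset.measurableSet _).compl]
  simp

variable [SecondCountableTopology X]

lemma wassersteinDist_empiricalMeasure_le {n : ℕ} (x y : Fin n → X) :
    wassersteinDist (empiricalMeasure x) (empiricalMeasure y) ≤
      (n : ℝ≥0∞)⁻¹ * ∑ i, edist (x i) (y i) := by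
  refine (wassersteinDist_le_lintegral
    (γ := empiricalMeasure fun i => (x i, y i)) ⟨?_, ?_⟩).trans (le_of_eq ?_)
  · rw [empiricalMeasure, Measure.map_smul, Measure.map_finset_sum measurable_fst.aemeasurable]
    simp [empiricalMeasure, Measure.map_dirac' measurable_fst]
  · rw [empiricalMeasure, Measure.map_smul, Measure.map_finset_sum measurable_snd.aemeasurable]
    simp [empiricalMeasure, Measure.map_dirac' measurable_snd]
  · rw [lintegral_empiricalMeasure _ measurable_edist]

lemma wassersteinDist_le_add_sum_edist (μ : Measure X) {n : ℕ} (hn : 0 < n) (x y : Fin n → X) :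
    wassersteinDist μ (empiricalMeasure x) ≤
      wassersteinDist μ (empiricalMeasure y) + (n : ℝ≥0∞)⁻¹ * ∑ i, edist (x i) (y i) := by
  have := isProbabilityMeasure_empiricalMeasure hn y
  obtain ⟨F, hF⟩ := exists_finset_empiricalMeasure_compl_eq_zero y
  refine (wassersteinDist_triangle hF).trans (add_le_add le_rfl ?_)
  simpa only [edist_comm] using wassersteinDist_empiricalMeasure_le y x

/-- Moving each sample point by at most `δ` changes the distance by at most `δ`, so the map is even
continuous. -/
lemma measurable_wassersteinDist_empiricalMeasure (μ : Measure X) {n : ℕ} (hn : 0 < n) :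
    Measurable fun x : Fin n → X => wassersteinDist μ (empiricalMeasure x) := by
  refine Continuous.measurable (continuous_of_le_add_edist 1 (by simp) fun x y => ?_)
  refine (wassersteinDist_le_add_sum_edist μ hn x y).trans (add_le_add le_rfl ?_)
  calc (n : ℝ≥0∞)⁻¹ * ∑ i, edist (x i) (y i)
      ≤ (n : ℝ≥0∞)⁻¹ * ∑ _i : Fin n, edist x y := by
        gcongr with i; exact edist_le_pi_edist x y i
    _ = 1 * edist x y := by
        rw [Finset.sum_const, Finset.card_univ, Fintype.card_fin, nsmul_eq_mul, ← mul_assoc,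
          ENNReal.inv_mul_cancel (by simp [hn.ne']) (by simp)]

end Empirical

/-! ### McDiarmid's inequality -/

section McDiarmid

lemma hasSubgaussianMGF_sub_integral_of_dist_le {S : Type*} [MeasurableSpace S] {μ : Measure S}
    [IsProbabilityMeasure μ] {f : S → ℝ} (hf : Measurable f) {c : ℝ≥0}
    (hc : ∀ a b, |f a - f b| ≤ c) :
    HasSubgaussianMGF (fun a => f a - ∫ b, f b ∂μ) ((c / 2) ^ 2) μ := by
  obtain ⟨a₀⟩ : Nonempty S := nonempty_of_isProbabilityMeasure μ
  have hbdd : BddBelow (Set.range f) := ⟨f a₀ - c, by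
    rintro _ ⟨a, rfl⟩
    have := abs_le.1 (hc a a₀)
    linarith [this.1]⟩
  -- Oscillation at most `c` puts `f` in an interval of length `c` starting at its infimum, and
  -- Hoeffding's lemma applies.
  have h := hasSubgaussianMGF_of_mem_Icc (μ := μ) (a := sInf (Set.range f))
    (b := sInf (Set.range f) + c) hf.aemeasurable (ae_of_all _ fun a => ⟨?_, ?_⟩)
  · simpa using h
  · exact csInf_le hbdd ⟨a, rfl⟩
  · rw [← sub_le_iff_le_add]
    refine le_csInf ⟨f a₀, a₀, rfl⟩ ?_
    rintro _ ⟨b, rfl⟩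
    have := abs_le.1 (hc a b)
    linarith [this.2]

/-- **McDiarmid's inequality**, as a bound on the moment generating function: a bounded
function of `n` independent variables with differences bounded by `c` is sub-Gaussian. -/
lemma hasSubgaussianMGF_pi_of_bounded_differences {S : Type*} [MeasurableSpace S] {μ : Measure S}
    [IsProbabilityMeasure μ] (c : ℝ≥0) (M : ℝ) : ∀ (n : ℕ) (g : (Fin n → S) → ℝ), Measurable g →
      (∀ x, |g x| ≤ M) → (∀ x i a, |g (Function.update x i a) - g x| ≤ c) →
      HasSubgaussianMGF (fun x => g x - ∫ y, g y ∂Measure.pi fun _ => μ) (n * (c / 2) ^ 2)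
        (Measure.pi fun _ => μ) := by
  intro n
  induction n with
  | zero =>
    intro g _ _ _
    have : (fun x : Fin 0 → S => g x - ∫ y, g y ∂Measure.pi fun _ => μ) = fun _ => 0 := by
      funext x
      have : ∀ y, g y = g x := fun y => by rw [Subsingleton.elim y x]
      simp [this]
    rw [this]
    simp
  | succ n ih =>
    intro g hg hM hc
    set ρ : Measure (Fin n → S) := Measure.pi fun _ => μ
    set e := MeasurableEquiv.piFinSuccAbove (fun _ : Fin (n + 1) => S) 0
    have he : MeasurePreserving e (Measure.pi fun _ => μ) (μ.prod ρ) :=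
      measurePreserving_piFinSuccAbove (fun _ : Fin (n + 1) => μ) 0
    let h : S × (Fin n → S) → ℝ := fun z => g (e.symm z)
    have hh : Measurable h := hg.comp e.symm.measurable
    have hsymm : ∀ a x, e.symm (a, x) = Fin.cons a x := fun a x =>
      Fin.insertNth_zero' a x
    have hhM : ∀ z, |h z| ≤ M := fun z => hM _
    have hint : Integrable h (μ.prod ρ) :=
      Integrable.of_bound hh.aestronglyMeasurable M (ae_of_all _ hhM)
    -- Averaging out the first coordinate keeps the bounded differences, so the induction hypothesis
    -- covers `G`; given the others, `h - G` is sub-Gaussian by Hoeffding, and the two exponential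
    -- bounds multiply.
    let G : (Fin n → S) → ℝ := fun x => ∫ a, h (a, x) ∂μ
    have hGm : Measurable G := (hh.stronglyMeasurable.integral_prod_left' (μ := μ)).measurable
    have hinta : ∀ x, Integrable (fun a => h (a, x)) μ := fun x =>
      Integrable.of_bound (hh.comp measurable_prodMk_right).aestronglyMeasurable M
        (ae_of_all _ fun a => hhM _)
    have hGM : ∀ x, |G x| ≤ M := fun x => by
      have := norm_integral_le_of_norm_le_const (μ := μ) (f := fun a => h (a, x)) (C := M)
        (ae_of_all _ fun a => hhM (a, x))
      simpa using this
    have hGc : ∀ x i a, |G (Function.update x i a) - G x| ≤ c := fun x i a => by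
      simp only [G]
      rw [← integral_sub (hinta _) (hinta _)]
      have := norm_integral_le_of_norm_le_const (μ := μ)
        (f := fun b => h (b, Function.update x i a) - h (b, x)) (C := c) (ae_of_all _ fun b => by
          simp only [h, hsymm, Fin.cons_update]
          exact hc _ _ _)
      simpa using this
    have hGint : ∫ x, G x ∂ρ = ∫ y, g y ∂Measure.pi fun _ => μ := by
      rw [← he.symm.integral_comp' g]
      exact (integral_prod_symm h hint).symm
    have hG := ih G hGm hGM hGc
    rw [hGint] at hG
    set m := ∫ y, g y ∂Measure.pi fun _ => μ
    have hcond : ∀ x, HasSubgaussianMGF (fun a => h (a, x) - G x) ((c / 2) ^ 2) μ := fun x => by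
      refine hasSubgaussianMGF_sub_integral_of_dist_le (hh.comp measurable_prodMk_right)
        fun a b => ?_
      have := hc (Fin.cons b x) 0 a
      rw [Fin.update_cons_zero] at this
      change |h (a, x) - h (b, x)| ≤ c
      simpa only [h, hsymm] using this
    have hexp : ∀ t : ℝ, Integrable (fun z => Real.exp (t * (h z - m))) (μ.prod ρ) := fun t =>
      integrable_exp_mul_of_mem_Icc (a := -M - m) (b := M - m) (hh.sub_const m).aemeasurable
        (ae_of_all _ fun z => ⟨by linarith [(abs_le.1 (hhM z)).1],
          by linarith [(abs_le.1 (hhM z)).2]⟩)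
    have key : HasSubgaussianMGF (fun z => h z - m) ((n + 1 : ℕ) * (c / 2) ^ 2) (μ.prod ρ) := by
      refine ⟨hexp, fun t => ?_⟩
      rw [mgf, integral_prod_symm _ (hexp t)]
      have hle : ∀ x, ∫ a, Real.exp (t * (h (a, x) - m)) ∂μ ≤
          Real.exp (t * (G x - m)) * Real.exp (((c / 2) ^ 2 : ℝ≥0) * t ^ 2 / 2) := fun x => by
        have h1 : ∀ a, Real.exp (t * (h (a, x) - m)) =
            Real.exp (t * (G x - m)) * Real.exp (t * (h (a, x) - G x)) := fun a => by
          rw [← Real.exp_add]; ring_nf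
        simp only [h1]
        rw [integral_const_mul]
        gcongr
        exact (hcond x).mgf_le t
      calc ∫ x, ∫ a, Real.exp (t * (h (a, x) - m)) ∂μ ∂ρ
          ≤ ∫ x, Real.exp (t * (G x - m)) * Real.exp (((c / 2) ^ 2 : ℝ≥0) * t ^ 2 / 2) ∂ρ :=
            integral_mono (hexp t).integral_prod_right ((hG.integrable_exp_mul t).mul_const _) hle
        _ = mgf (fun x => G x - m) ρ t * Real.exp (((c / 2) ^ 2 : ℝ≥0) * t ^ 2 / 2) := by
            rw [integral_mul_const]; rfl
        _ ≤ Real.exp ((n * (c / 2) ^ 2 : ℝ≥0) * t ^ 2 / 2) *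
              Real.exp (((c / 2) ^ 2 : ℝ≥0) * t ^ 2 / 2) := by
            gcongr
            exact hG.mgf_le t
        _ = _ := by
            rw [← Real.exp_add]
            congr 1
            push_cast
            ring
    rw [← he.map_eq] at key
    have := HasSubgaussianMGF.of_map he.measurable.aemeasurable key
    refine this.congr (ae_of_all _ fun x => ?_)
    simp [h]

/-- The upper tail in McDiarmid's inequality with differences `1 / n`. -/
lemma measureReal_pi_ge_le_exp {S : Type*} [MeasurableSpace S] {μ : Measure S}
    [IsProbabilityMeasure μ] {n : ℕ} (hn : 0 < n) {g : (Fin n → S) → ℝ} (hg : Measurable g)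
    {M : ℝ} (hM : ∀ x, |g x| ≤ M)
    (hc : ∀ x i a, |g (Function.update x i a) - g x| ≤ (n : ℝ)⁻¹) {t : ℝ} (ht : 0 ≤ t) :
    (Measure.pi fun _ : Fin n => μ).real {x | t ≤ g x - ∫ y, g y ∂Measure.pi fun _ => μ} ≤
      Real.exp (-2 * n * t ^ 2) := by
  have h := hasSubgaussianMGF_pi_of_bounded_differences (μ := μ) (n : ℝ≥0)⁻¹ M n g hg hM
    (by simpa using hc)
  refine (h.measure_ge_le ht).trans (le_of_eq ?_)
  have : (n : ℝ) ≠ 0 := by positivity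
  congr 1
  push_cast
  field_simp

end McDiarmid

/-! ### Mean excess of a partition -/

section ExpectedExcess

/-- Nonnegativity of the variance of `|Y|`. -/
lemma integral_abs_le_sqrt_integral_sq {Ω : Type*} [MeasurableSpace Ω] {P : Measure Ω}
    [IsProbabilityMeasure P] {Y : Ω → ℝ} (hY : MemLp Y 2 P) :
    ∫ ω, |Y ω| ∂P ≤ Real.sqrt (∫ ω, Y ω ^ 2 ∂P) := by
  refine Real.le_sqrt_of_sq_le ?_
  have h := variance_nonneg |Y| P
  rw [variance_eq_sub hY.abs] at h
  simpa using h

variable {X : Type u} [MeasurableSpace X]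

lemma measurable_sub_empiricalMeasure (μ : Measure X) {n : ℕ} {Q : Set X} (hQ : MeasurableSet Q) :
    Measurable fun x : Fin n → X => μ Q - empiricalMeasure x Q := by
  simp only [empiricalMeasure_apply _ hQ]
  refine measurable_const.sub (measurable_const.mul ?_)
  exact Finset.measurable_sum _ fun j _ =>
    (measurable_one.indicator hQ).comp (measurable_pi_apply j)

lemma measurable_cellExcess_empiricalMeasure (μ : Measure X) {n : ℕ} {π : X → ℕ}
    (hπ : Measurable π) (N : ℕ) :
    Measurable fun x : Fin n → X => cellExcess π N μ (empiricalMeasure x) :=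
  Finset.measurable_sum _ fun i _ =>
    measurable_sub_empiricalMeasure μ (hπ (measurableSet_singleton i))

lemma measurable_lintegral_empiricalMeasure {n : ℕ} {b : X → ℝ≥0∞} (hb : Measurable b) :
    Measurable fun x : Fin n → X => ∫⁻ y, b y ∂empiricalMeasure x := by
  simp only [lintegral_empiricalMeasure _ hb]
  exact measurable_const.mul
    (Finset.measurable_sum _ fun i _ => hb.comp (measurable_pi_apply i))

variable {μ : Measure X} [IsProbabilityMeasure μ]

lemma variance_empirical_frequency_le {n : ℕ} (hn : 0 < n) {Q : Set X} (hQ : MeasurableSet Q) :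
    ∫ x, (μ.real Q - (n : ℝ)⁻¹ * ∑ i, Q.indicator 1 (x i)) ^ 2 ∂(Measure.pi fun _ : Fin n => μ) ≤
      μ.real Q / n := by
  have hn' : (n : ℝ) ≠ 0 := by positivity
  have hf : Measurable (Q.indicator (1 : X → ℝ)) := measurable_one.indicator hQ
  have hL : MemLp (Q.indicator (1 : X → ℝ)) 2 μ := by
    refine MemLp.of_bound hf.aestronglyMeasurable 1 (ae_of_all _ fun x => ?_)
    by_cases h : x ∈ Q <;> simp [h]
  have hLi : ∀ i : Fin n, MemLp (fun x : Fin n → X => Q.indicator (1 : X → ℝ) (x i)) 2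
      (Measure.pi fun _ : Fin n => μ) := fun i =>
    hL.comp_measurePreserving (measurePreserving_eval (fun _ : Fin n => μ) i)
  have hmean : ∀ i : Fin n, ∫ x : Fin n → X, Q.indicator (1 : X → ℝ) (x i)
      ∂(Measure.pi fun _ : Fin n => μ) = μ.real Q := fun i => by
    rw [integral_comp_eval (μ := fun _ : Fin n => μ) hf.aestronglyMeasurable]
    simp [integral_indicator_one hQ]
  have hsum : MemLp (fun x : Fin n → X => ∑ i, Q.indicator (1 : X → ℝ) (x i)) 2
      (Measure.pi fun _ : Fin n => μ) := memLp_finsetSum _ fun i _ => hLi i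
  have hvar := variance_sum_pi (μ := fun _ : Fin n => μ)
    (X := fun _ : Fin n => Q.indicator (1 : X → ℝ)) fun _ => hL
  have hmeanS : ∫ x : Fin n → X, ∑ i, Q.indicator (1 : X → ℝ) (x i)
      ∂(Measure.pi fun _ : Fin n => μ) = n * μ.real Q := by
    rw [integral_finsetSum _ fun i _ => (hLi i).integrable (by norm_num)]
    simp [hmean]
  have hvar1 : variance (Q.indicator (1 : X → ℝ)) μ ≤ μ.real Q := by
    refine (variance_le_expectation_sq hf.aestronglyMeasurable).trans (le_of_eq ?_)
    rw [← integral_indicator_one hQ]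
    refine integral_congr_ae (ae_of_all _ fun x => ?_)
    by_cases h : x ∈ Q <;> simp [h]
  rw [variance_eq_integral (by simpa [Finset.sum_fn] using hsum.aestronglyMeasurable.aemeasurable)] at hvar
  simp only [Finset.sum_apply, hmeanS] at hvar
  have : ∀ x : Fin n → X, (μ.real Q - (n : ℝ)⁻¹ * ∑ i, Q.indicator (1 : X → ℝ) (x i)) ^ 2 =
      ((n : ℝ)⁻¹) ^ 2 * (∑ i, Q.indicator (1 : X → ℝ) (x i) - n * μ.real Q) ^ 2 := fun x => by
    rw [← mul_pow, mul_sub, ← mul_assoc, inv_mul_cancel₀ hn']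
    ring
  simp only [this]
  rw [integral_const_mul, hvar]
  calc ((n : ℝ)⁻¹) ^ 2 * ∑ _i : Fin n, variance (Q.indicator (1 : X → ℝ)) μ
      ≤ ((n : ℝ)⁻¹) ^ 2 * ∑ _i : Fin n, μ.real Q := by gcongr
    _ = μ.real Q / n := by simp; field_simp

lemma lintegral_sub_empiricalMeasure_le {n : ℕ} (hn : 0 < n) {Q : Set X} (hQ : MeasurableSet Q) :
    ∫⁻ x, (μ Q - empiricalMeasure x Q) ∂(Measure.pi fun _ : Fin n => μ) ≤
      ENNReal.ofReal (Real.sqrt (μ.real Q / n)) := by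
  have hf : Measurable (Q.indicator (1 : X → ℝ)) := measurable_one.indicator hQ
  let Y : (Fin n → X) → ℝ := fun x => μ.real Q - (n : ℝ)⁻¹ * ∑ i, Q.indicator 1 (x i)
  have hYm : Measurable Y := by
    refine measurable_const.sub (measurable_const.mul ?_)
    exact Finset.measurable_sum _ fun i _ => hf.comp (measurable_pi_apply i)
  have hemp : ∀ x : Fin n → X, empiricalMeasure x Q =
      ENNReal.ofReal ((n : ℝ)⁻¹ * ∑ i, Q.indicator 1 (x i)) := fun x => by
    rw [empiricalMeasure_apply x hQ, ENNReal.ofReal_mul (by positivity),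
      ENNReal.ofReal_inv_of_pos (by positivity), ENNReal.ofReal_natCast,
      ENNReal.ofReal_sum_of_nonneg fun i _ => Set.indicator_nonneg (by simp) _]
    congr 1
    refine Finset.sum_congr rfl fun i _ => ?_
    by_cases h : x i ∈ Q <;> simp [h]
  have hle : ∀ x : Fin n → X, μ Q - empiricalMeasure x Q ≤ ENNReal.ofReal |Y x| := fun x => by
    rw [hemp, ← ofReal_measureReal (measure_ne_top μ Q), ← ENNReal.ofReal_sub _ (by
      have : ∀ i, 0 ≤ Q.indicator (1 : X → ℝ) (x i) := fun i => Set.indicator_nonneg (by simp) _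
      exact mul_nonneg (by positivity) (Finset.sum_nonneg fun i _ => this i))]
    exact ENNReal.ofReal_le_ofReal (le_abs_self _)
  have hYL : MemLp Y 2 (Measure.pi fun _ : Fin n => μ) := by
    refine MemLp.of_bound hYm.aestronglyMeasurable 1 (ae_of_all _ fun x => ?_)
    have h0 : ∀ i, 0 ≤ Q.indicator (1 : X → ℝ) (x i) := fun i => Set.indicator_nonneg (by simp) _
    have h1 : ∑ i, Q.indicator (1 : X → ℝ) (x i) ≤ n := by
      refine (Finset.sum_le_sum (g := fun _ => (1 : ℝ)) fun i _ => ?_).trans (by simp)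
      by_cases h : x i ∈ Q <;> simp [h]
    have h2 : (n : ℝ)⁻¹ * ∑ i, Q.indicator (1 : X → ℝ) (x i) ≤ 1 := by
      rw [inv_mul_le_iff₀ (by positivity)]
      simpa using h1
    have h3 : 0 ≤ (n : ℝ)⁻¹ * ∑ i, Q.indicator (1 : X → ℝ) (x i) :=
      mul_nonneg (by positivity) (Finset.sum_nonneg fun i _ => h0 i)
    have h4 : μ.real Q ≤ 1 := measureReal_le_one
    have h5 : 0 ≤ μ.real Q := measureReal_nonneg
    rw [Real.norm_eq_abs, abs_le]
    constructor <;> simp only [Y] <;> linarith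
  calc ∫⁻ x, (μ Q - empiricalMeasure x Q) ∂(Measure.pi fun _ : Fin n => μ)
      ≤ ∫⁻ x, ENNReal.ofReal |Y x| ∂(Measure.pi fun _ : Fin n => μ) := lintegral_mono hle
    _ = ENNReal.ofReal (∫ x, |Y x| ∂(Measure.pi fun _ : Fin n => μ)) :=
        (ofReal_integral_eq_lintegral_ofReal (hYL.integrable (by norm_num)).abs
          (ae_of_all _ fun _ => abs_nonneg _)).symm
    _ ≤ _ := by
        refine ENNReal.ofReal_le_ofReal ((integral_abs_le_sqrt_integral_sq hYL).trans ?_)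
        exact Real.sqrt_le_sqrt (variance_empirical_frequency_le hn hQ)

lemma sum_measureReal_fiber {π : X → ℕ} (hπ : Measurable π) {N : ℕ} (hN : ∀ x, π x < N) :
    ∑ i ∈ Finset.range N, μ.real (π ⁻¹' {i}) = 1 := by
  rw [← measureReal_biUnion_finset]
  · have : (⋃ i ∈ Finset.range N, π ⁻¹' {i}) = Set.univ := by
      ext x; simpa using hN x
    rw [this, probReal_univ]
  · intro i _ j _ hij
    refine Set.disjoint_left.2 fun x hx hx' => hij ?_
    exact (hx : π x = i).symm.trans hx'
  · exact fun i _ => hπ (measurableSet_singleton i)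

/-- A partition into `N` cells has expected empirical excess at most `√(N / n)`. -/
lemma lintegral_cellExcess_le {n : ℕ} (hn : 0 < n) {π : X → ℕ} (hπ : Measurable π) {N : ℕ}
    (hN : ∀ x, π x < N) :
    ∫⁻ x, cellExcess π N μ (empiricalMeasure x) ∂(Measure.pi fun _ : Fin n => μ) ≤
      ENNReal.ofReal (Real.sqrt (N / n)) := by
  have hQ : ∀ i, MeasurableSet (π ⁻¹' {i}) := fun i => hπ (measurableSet_singleton i)
  simp only [cellExcess]
  rw [lintegral_finsetSum]
  · refine (Finset.sum_le_sum fun i _ => lintegral_sub_empiricalMeasure_le hn (hQ i)).trans ?_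
    rw [← ENNReal.ofReal_sum_of_nonneg fun i _ => Real.sqrt_nonneg _]
    refine ENNReal.ofReal_le_ofReal (Real.le_sqrt_of_sq_le ?_)
    refine (sq_sum_le_card_mul_sum_sq).trans (le_of_eq ?_)
    rw [Finset.card_range, div_eq_mul_inv]
    congr 1
    rw [Finset.sum_congr rfl fun i _ => Real.sq_sqrt (by positivity : 0 ≤ μ.real (π ⁻¹' {i}) / n),
      ← Finset.sum_div, sum_measureReal_fiber hπ hN, one_div]
  · exact fun i _ => measurable_sub_empiricalMeasure μ (hQ i)

lemma lintegral_lintegral_empiricalMeasure {n : ℕ} (hn : 0 < n) {b : X → ℝ≥0∞}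
    (hb : Measurable b) :
    ∫⁻ x, ∫⁻ y, b y ∂empiricalMeasure x ∂(Measure.pi fun _ : Fin n => μ) = ∫⁻ y, b y ∂μ := by
  simp only [lintegral_empiricalMeasure _ hb]
  have hm : ∀ i : Fin n, Measurable fun x : Fin n → X => b (x i) := fun i =>
    hb.comp (measurable_pi_apply i)
  rw [lintegral_const_mul _ (Finset.measurable_sum _ fun i _ => hm i),
    lintegral_finsetSum _ fun i _ => hm i]
  have : ∀ i : Fin n, ∫⁻ x : Fin n → X, b (x i) ∂(Measure.pi fun _ : Fin n => μ) =
      ∫⁻ y, b y ∂μ := fun i =>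
    (measurePreserving_eval (fun _ : Fin n => μ) i).lintegral_comp hb
  simp only [this, Finset.sum_const, Finset.card_univ, Fintype.card_fin, nsmul_eq_mul]
  rw [← mul_assoc, ENNReal.inv_mul_cancel (by simp [hn.ne']) (by simp), one_mul]

end ExpectedExcess

/-! ### Covers from the Wasserstein dimension -/

section Covers

variable {X : Type u} [MetricSpace X]

lemma exists_centers_of_ballCoveringNumber_lt {ε : ℝ} {A : Set X} (hA : A.Nonempty) {N : ℕ}
    (h : ballCoveringNumber ε A < (N + 1 : ℕ)) :
    0 < N ∧ ∃ e : ℕ → X, ∀ x ∈ A, ∃ i < N, edist x (e i) ≤ ENNReal.ofReal (ε / 2) := by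
  classical
  simp only [ballCoveringNumber, Metric.externalCoveringNumber, iInf_lt_iff] at h
  obtain ⟨C, hC, hCN⟩ := h
  have hfin : C.Finite := Set.finite_of_encard_le_coe hCN.le
  have hcard : hfin.toFinset.card ≤ N := by
    rw [hfin.encard_eq_coe_toFinset_card] at hCN
    have : hfin.toFinset.card < N + 1 := by exact_mod_cast hCN
    omega
  have hcover : ∀ x ∈ A, ∃ c ∈ C, edist x c ≤ ENNReal.ofReal (ε / 2) := fun x hx => hC hx
  obtain ⟨x₀, hx₀⟩ := hA
  let f := hfin.toFinset.equivFin
  refine ⟨?_, fun i => if h : i < hfin.toFinset.card then (f.symm ⟨i, h⟩ : X) else x₀,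
    fun x hx => ?_⟩
  · obtain ⟨c, hc, _⟩ := hcover x₀ hx₀
    exact (Finset.card_pos.2 ⟨c, hfin.mem_toFinset.2 hc⟩).trans_le hcard
  · obtain ⟨c, hc, hxc⟩ := hcover x hx
    have hi := (f ⟨c, hfin.mem_toFinset.2 hc⟩).2
    exact ⟨f ⟨c, hfin.mem_toFinset.2 hc⟩, hi.trans_le hcard, by simpa [hi] using hxc⟩

variable [MeasurableSpace X]

lemma exists_cover_of_epsDimension_lt {μ : Measure X} [IsProbabilityMeasure μ] {ε ζ s : ℝ}
    (hε : 0 < ε) (hε1 : ε < 1) (hζ : ζ < 1) (h : epsDimension μ ε ζ < (s : EReal)) :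
    ∃ A : Set X, MeasurableSet A ∧ 1 - ENNReal.ofReal ζ ≤ μ A ∧ ∃ N : ℕ, 0 < N ∧
      (N : ℝ) ≤ ε ^ (-s) ∧
      ∃ e : ℕ → X, ∀ x ∈ A, ∃ i < N, edist x (e i) ≤ ENNReal.ofReal (ε / 2) := by
  have hlog : Real.log ε < 0 := Real.log_neg hε hε1
  have hfin : massCoveringNumber μ ε ζ ≠ ⊤ := by
    -- An infinite covering number gives dimension `⊥ / (negative) = ⊤`, which is not below `s`.
    intro htop
    rw [epsDimension, htop] at h
    have : ((⊤ : ℕ∞) : ℝ≥0∞) = ⊤ := rfl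
    rw [this, ENNReal.log_top, EReal.neg_top,
      EReal.bot_div_of_neg_ne_bot (by exact_mod_cast hlog) (EReal.coe_ne_bot _)] at h
    exact not_top_lt h
  obtain ⟨N, hN⟩ := ENat.ne_top_iff_exists.1 hfin
  have hlt : massCoveringNumber μ ε ζ < (N + 1 : ℕ) := by
    rw [← hN]; exact_mod_cast Nat.lt_succ_self N
  simp only [massCoveringNumber, iInf_lt_iff] at hlt
  obtain ⟨A, hAm, hA, hcov⟩ := hlt
  have hne : A.Nonempty := by
    rw [Set.nonempty_iff_ne_empty]
    rintro rfl
    rw [measure_empty, nonpos_iff_eq_zero, tsub_eq_zero_iff_le, ENNReal.one_le_ofReal] at hA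
    linarith
  obtain ⟨hNpos, e, he⟩ := exists_centers_of_ballCoveringNumber_lt hne hcov
  refine ⟨A, hAm, hA, N, hNpos, ?_, e, he⟩
  have hN0 : (0 : ℝ) < N := by exact_mod_cast hNpos
  rw [epsDimension, ← hN] at h
  have hcast : (((N : ℕ∞)) : ℝ≥0∞) = ENNReal.ofReal N := by simp
  rw [hcast, ENNReal.log_ofReal_of_pos hN0, ← EReal.coe_neg, ← EReal.coe_div,
    EReal.coe_lt_coe_iff, div_lt_iff_of_neg hlog] at h
  rw [← Real.log_le_log_iff hN0 (Real.rpow_pos_of_pos hε _), Real.log_rpow hε]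
  linarith

/-- Above the upper Wasserstein dimension, all small scales admit economical covers of
large sets. -/
lemma eventually_exists_cover {μ : Measure X} [IsProbabilityMeasure μ] {σ : ℝ}
    (h : upperWassersteinDim μ < (σ : EReal)) :
    ∃ s : ℝ, 2 < s ∧ s < σ ∧ ∀ᶠ ε in 𝓝[>] (0 : ℝ), ∃ A : Set X, MeasurableSet A ∧
      μ Aᶜ ≤ ENNReal.ofReal (ε ^ (s / (s - 2))) ∧ ∃ N : ℕ, 0 < N ∧ (N : ℝ) ≤ ε ^ (-s) ∧
      ∃ e : ℕ → X, ∀ x ∈ A, ∃ i < N, edist x (e i) ≤ ENNReal.ofReal (ε / 2) := by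
  rw [upperWassersteinDim, sInf_lt_iff] at h
  obtain ⟨_, ⟨φ, ⟨hφ2, hφ⟩, rfl⟩, hφσ⟩ := h
  have hφσ' : φ < σ := EReal.coe_lt_coe_iff.1 hφσ
  refine ⟨(φ + σ) / 2, by linarith, by linarith, ?_⟩
  set s := (φ + σ) / 2 with hs
  have hφs : φ < s := by linarith
  have hev := eventually_lt_of_limsup_lt (lt_of_le_of_lt hφ (by exact_mod_cast hφs :
    (φ : EReal) < (s : EReal)))
  have hlt1 : ∀ᶠ ε in 𝓝[>] (0 : ℝ), ε ∈ Set.Ioo (0 : ℝ) 1 := Ioo_mem_nhdsGT one_pos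
  filter_upwards [hev, hlt1] with ε hε hε01
  -- The map `φ ↦ φ / (φ - 2)` decreases, so for `ε < 1` the mass allowed at `φ` is at most that
  -- allowed at `s`.
  have hexp : s / (s - 2) ≤ φ / (φ - 2) := by
    rw [div_le_div_iff₀ (by linarith) (by linarith)]
    nlinarith
  have hpos : 0 < φ / (φ - 2) := div_pos (by linarith) (by linarith)
  obtain ⟨A, hAm, hA, H⟩ := exists_cover_of_epsDimension_lt hε01.1 hε01.2
    (Real.rpow_lt_one hε01.1.le hε01.2 hpos) hε
  refine ⟨A, hAm, ?_, H⟩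
  rw [prob_compl_eq_one_sub hAm]
  rw [tsub_le_iff_right, add_comm, ← tsub_le_iff_right]
  refine le_trans (tsub_le_tsub_left (ENNReal.ofReal_le_ofReal ?_) _) hA
  exact Real.rpow_le_rpow_of_exponent_ge hε01.1 hε01.2.le hexp

end Covers

/-! ### Nested measurable partitions -/

section Partitions

variable {X : Type u} [MetricSpace X]

/-- Send a whole cell to a coarse ball containing one of its points in `A`. Acting on labels makes
the new partition coarser and measurable for free, at the price of the extra `2 * r` in diameter. -/
lemma exists_coarsening {π : X → ℕ} {A : Set X} {r ρ : ℝ≥0∞}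
    (hr : ∀ x ∈ A, ∀ y ∈ A, π x = π y → edist x y ≤ r) {N : ℕ} (hN : 0 < N) {e : ℕ → X}
    (he : ∀ x ∈ A, ∃ i < N, edist x (e i) ≤ ρ) :
    ∃ τ : ℕ → ℕ, (∀ i, τ i < N) ∧
      ∀ x ∈ A, ∀ y ∈ A, τ (π x) = τ (π y) → edist x y ≤ 2 * r + 2 * ρ := by
  have : ∀ i, ∃ j < N, ∀ x ∈ A, π x = i → edist x (e j) ≤ r + ρ := by
    intro i
    by_cases h : ∃ z ∈ A, π z = i
    · obtain ⟨z, hz, rfl⟩ := h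
      obtain ⟨j, hj, hzj⟩ := he z hz
      exact ⟨j, hj, fun x hx hxz =>
        (edist_triangle x z (e j)).trans (add_le_add (hr x hx z hz hxz) hzj)⟩
    · exact ⟨0, hN, fun x hx hxi => absurd ⟨x, hx, hxi⟩ h⟩
  choose τ hτN hτ using this
  refine ⟨τ, hτN, fun x hx y hy hxy => ?_⟩
  have h1 := hτ _ x hx rfl
  have h2 := hτ _ y hy rfl
  rw [← hxy] at h2
  calc edist x y ≤ edist x (e (τ (π x))) + edist y (e (τ (π x))) := edist_triangle_right _ _ _
    _ ≤ (r + ρ) + (r + ρ) := add_le_add h1 h2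
    _ = 2 * r + 2 * ρ := by ring

variable [MeasurableSpace X]

lemma exists_measurable_partition [OpensMeasurableSpace X] {A : Set X} {ρ : ℝ≥0∞} {N : ℕ} (hN : 0 < N) {e : ℕ → X}
    (he : ∀ x ∈ A, ∃ i < N, edist x (e i) ≤ ρ) :
    ∃ π : X → ℕ, Measurable π ∧ (∀ x, π x < N) ∧
      ∀ x ∈ A, ∀ y ∈ A, π x = π y → edist x y ≤ 2 * ρ := by
  -- The nearest centre among `e 0, …, e (N - 1)`: the index bound is inclusive, hence `N - 1`.
  refine ⟨SimpleFunc.nearestPtInd e (N - 1), (SimpleFunc.nearestPtInd e (N - 1)).measurable,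
    fun x => ?_, fun x hx y hy hxy => ?_⟩
  · have := SimpleFunc.nearestPtInd_le e (N - 1) x
    omega
  · have key : ∀ x ∈ A, edist (e (SimpleFunc.nearestPtInd e (N - 1) x)) x ≤ ρ := by
      intro x hx
      obtain ⟨i, hi, hxi⟩ := he x hx
      rw [edist_comm] at hxi
      exact (SimpleFunc.edist_nearestPt_le e x (by omega : i ≤ N - 1)).trans hxi
    have h2 := key y hy
    rw [← hxy] at h2
    calc edist x y ≤ _ := edist_triangle_left _ _ _
      _ ≤ ρ + ρ := add_le_add (key x hx) h2
      _ = 2 * ρ := by ring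

lemma exists_nested_partitions [OpensMeasurableSpace X] {A : Set X} {ρ R : ℕ → ℝ≥0∞} {N : ℕ → ℕ} (hN : ∀ k, 0 < N k)
    {e : ℕ → ℕ → X} (he : ∀ k, ∀ x ∈ A, ∃ i < N k, edist x (e k i) ≤ ρ k)
    (hR0 : 2 * ρ 0 ≤ R 0) (hR : ∀ k, 2 * R k + 2 * ρ (k + 1) ≤ R (k + 1)) :
    ∃ (π : ℕ → X → ℕ) (τ : ℕ → ℕ → ℕ), (∀ k, Measurable (π k)) ∧ (∀ k x, π k x < N k) ∧
      (∀ k, π (k + 1) = τ k ∘ π k) ∧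
      ∀ k, ∀ x ∈ A, ∀ y ∈ A, π k x = π k y → edist x y ≤ R k := by
  let P : ℕ → Type u := fun k => {π : X → ℕ // Measurable π ∧ (∀ x, π x < N k) ∧
    ∀ x ∈ A, ∀ y ∈ A, π x = π y → edist x y ≤ R k}
  obtain ⟨π₀, h1, h2, h3⟩ := exists_measurable_partition (hN 0) (he 0)
  have step : ∀ k (π : P k), ∃ (π' : P (k + 1)) (τ : ℕ → ℕ), π'.1 = τ ∘ π.1 := by
    rintro k ⟨π, hπ, hπN, hπr⟩
    obtain ⟨τ, hτN, hτ⟩ := exists_coarsening hπr (hN (k + 1)) (he (k + 1))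
    exact ⟨⟨τ ∘ π, measurable_from_top.comp hπ, fun x => hτN _,
      fun x hx y hy hxy => (hτ x hx y hy hxy).trans (hR k)⟩, τ, rfl⟩
  choose f τ hτ using step
  let part : ∀ k, P k := fun k =>
    Nat.rec ⟨π₀, h1, h2, fun x hx y hy hxy => (h3 x hx y hy hxy).trans hR0⟩ f k
  exact ⟨fun k => (part k).1, fun k => τ k (part k), fun k => (part k).2.1, fun k => (part k).2.2.1,
    fun k => hτ k (part k), fun k => (part k).2.2.2⟩

end Partitions

/-! ### Mean distance in terms of covers -/

section Expectation

variable {X : Type u} [MetricSpace X] [MeasurableSpace X] [BorelSpace X]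
  [SecondCountableTopology X] {μ : Measure X} [IsProbabilityMeasure μ]

lemma lintegral_wassersteinDist_le_multiscale (hμ : Metric.ediam μ.support ≤ 1) {n : ℕ}
    (hn : 0 < n) (K : ℕ) {A : ℕ → Set X} (hA : ∀ k, MeasurableSet (A k)) {ρ R : ℕ → ℝ≥0∞}
    {N : ℕ → ℕ} (hN : ∀ k, 0 < N k) {e : ℕ → ℕ → X}
    (he : ∀ k, ∀ x ∈ A k, ∃ i < N k, edist x (e k i) ≤ ρ k)
    (hR0 : 2 * ρ 0 ≤ R 0) (hR : ∀ k, 2 * R k + 2 * ρ (k + 1) ≤ R (k + 1)) :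
    ∫⁻ x, wassersteinDist μ (empiricalMeasure x) ∂(Measure.pi fun _ : Fin n => μ) ≤
      2 * ∑ k ∈ Finset.range (K + 1), μ (A k)ᶜ + R 0 +
        ∑ k ∈ Finset.range K, R (k + 1) * ENNReal.ofReal (Real.sqrt (N k / n)) +
        ENNReal.ofReal (Real.sqrt (N K / n)) := by
  classical
  have hS : MeasurableSet μ.support := Measure.isClosed_support.measurableSet
  set A' : Set X := ⋂ k ∈ Finset.range (K + 1), A k with hA'
  have hA'm : MeasurableSet A' := Finset.measurableSet_biInter _ fun k _ => hA k
  have hA'sub : ∀ k ≤ K, A' ⊆ A k := fun k hk =>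
    Set.biInter_subset_of_mem (Finset.mem_coe.2 (Finset.mem_range.2 (by omega)))
  -- Only levels up to `K` matter: the data are frozen beyond `K`, with diameter bound `⊤`, to
  -- supply an infinite sequence.
  obtain ⟨π, τ, hπ, hπN, hπτ, hπR⟩ := exists_nested_partitions (A := A')
    (ρ := fun k => ρ (min k K)) (R := fun k => if k ≤ K then R k else ⊤)
    (N := fun k => N (min k K)) (fun k => hN _) (e := fun k => e (min k K))
    (fun k x hx => he _ x (hA'sub _ (min_le_right _ _) hx)) (by simpa using hR0) (fun k => by
      by_cases hk : k + 1 ≤ K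
      · simpa [hk, (Nat.le_succ k).trans hk] using hR k
      · simp [hk])
  -- Cost `1` for an uncovered point suffices on a support of diameter at most `1`; cost `⊤` off the
  -- support is `μ`-null. The mean of `∫ b` under the empirical measure is `∫ b ∂μ`, hence the
  -- factor `2` in the bound.
  let b : X → ℝ≥0∞ := fun x => A'ᶜ.indicator 1 x + μ.supportᶜ.indicator (fun _ => ⊤) x
  have hb : Measurable b :=
    (measurable_one.indicator hA'm.compl).add (measurable_const.indicator hS.compl)
  have hbμ : ∫⁻ x, b x ∂μ ≤ ∑ k ∈ Finset.range (K + 1), μ (A k)ᶜ := by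
    simp only [b]
    rw [lintegral_add_left (measurable_one.indicator hA'm.compl), lintegral_indicator_one hA'm.compl,
      lintegral_indicator_const hS.compl, Measure.measure_compl_support, mul_zero, add_zero, hA']
    simp only [Set.compl_iInter]
    exact measure_biUnion_finset_le _ _
  let r : ℕ → ℝ≥0∞ := fun k => if k ≤ K then R k else 1
  have hbr : ∀ (r : ℝ≥0∞) (x y : X),
      (x ∈ μ.support → y ∈ μ.support → x ∈ A' → y ∈ A' → edist x y ≤ r) →
      edist x y ≤ r + b x + b y := by
    intro r x y h
    by_cases hx : x ∈ μ.support
    swap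
    · simp [b, hx]
    by_cases hy : y ∈ μ.support
    swap
    · simp [b, hy]
    have h1 : edist x y ≤ 1 := (Metric.edist_le_ediam_of_mem hx hy).trans hμ
    by_cases hxA : x ∈ A'
    · by_cases hyA : y ∈ A'
      · exact (h hx hy hxA hyA).trans (by rw [add_assoc]; exact le_self_add)
      · refine h1.trans (le_trans ?_ le_add_self)
        simp [b, hyA]
    · refine h1.trans ((le_trans ?_ le_add_self).trans le_self_add)
      simp [b, hxA]
  have hbr1 : ∀ x y : X, edist x y ≤ 1 + b x + b y := fun x y =>
    hbr 1 x y fun hx hy _ _ => (Metric.edist_le_ediam_of_mem hx hy).trans hμ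
  have hpt : ∀ x : Fin n → X, wassersteinDist μ (empiricalMeasure x) ≤
      ∫⁻ y, b y ∂μ + ∫⁻ y, b y ∂empiricalMeasure x + R 0 +
        ∑ k ∈ Finset.range (K + 1), r (k + 1) * cellExcess (π k) (N (min k K)) μ
          (empiricalMeasure x) := by
    intro x
    have := isProbabilityMeasure_empiricalMeasure hn x
    have h := wassersteinDist_le_multiscale hb K π τ (fun k => N (min k K)) r μ
      (empiricalMeasure x) (by simp) hπ hπN hπτ (fun k hk x y hxy => by
        refine hbr _ x y fun _ _ hx hy => ?_
        simpa [r, hk] using hπR k x hx y hy hxy) (fun x y => by simpa [r] using hbr1 x y)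
    simpa [r] using h
  refine (lintegral_mono hpt).trans ?_
  have hm2 := measurable_lintegral_empiricalMeasure (n := n) hb
  have hm3 : ∀ k, Measurable fun x : Fin n → X =>
      r (k + 1) * cellExcess (π k) (N (min k K)) μ (empiricalMeasure x) := fun k =>
    measurable_const.mul (measurable_cellExcess_empiricalMeasure μ (hπ k) _)
  have hm4 : Measurable fun x : Fin n → X => ∑ k ∈ Finset.range (K + 1),
      r (k + 1) * cellExcess (π k) (N (min k K)) μ (empiricalMeasure x) :=
    Finset.measurable_sum _ fun k _ => hm3 k
  rw [lintegral_add_right _ hm4, lintegral_add_right _ measurable_const,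
    lintegral_add_left measurable_const,
    lintegral_lintegral_empiricalMeasure hn hb, lintegral_finsetSum _ fun k _ => hm3 k]
  simp only [lintegral_const, measure_univ, mul_one]
  rw [two_mul, add_assoc _ (∑ k ∈ Finset.range K, _)]
  refine add_le_add (add_le_add (add_le_add hbμ hbμ) le_rfl) ?_
  have hterm : ∀ k ∈ Finset.range (K + 1),
      ∫⁻ x, r (k + 1) * cellExcess (π k) (N (min k K)) μ (empiricalMeasure x)
        ∂(Measure.pi fun _ : Fin n => μ) ≤
      r (k + 1) * ENNReal.ofReal (Real.sqrt (N k / n)) := by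
    intro k hk
    have hk' : min k K = k := min_eq_left (Nat.lt_succ_iff.1 (Finset.mem_range.1 hk))
    rw [lintegral_const_mul _ (measurable_cellExcess_empiricalMeasure μ (hπ k) _)]
    gcongr
    have := lintegral_cellExcess_le (μ := μ) hn (hπ k) (hπN k)
    rwa [hk'] at this ⊢
  refine (Finset.sum_le_sum hterm).trans ?_
  rw [Finset.sum_range_succ]
  refine add_le_add (Finset.sum_le_sum fun k hk => ?_) ?_
  · have : k + 1 ≤ K := Finset.mem_range.1 hk
    simp [r, this]
  · simp [r]

end Expectation

/-! ### Choice of scales, rate and concentration -/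

section Rate

lemma sqrt_div_le_rpow {n N : ℕ} (hn : 0 < n) {s a : ℝ}
    (hN : (N : ℝ) ≤ ((n : ℝ) ^ (-a)) ^ (-s)) :
    Real.sqrt (N / n) ≤ (n : ℝ) ^ ((s * a - 1) / 2) := by
  have hn0 : (0 : ℝ) < n := by exact_mod_cast hn
  rw [Real.sqrt_le_left (by positivity), ← Real.rpow_natCast, ← Real.rpow_mul hn0.le]
  rw [← Real.rpow_mul hn0.le] at hN
  have h1 : (s * a - 1) / 2 * (2 : ℕ) = -a * -s - 1 := by push_cast; ring
  rw [h1, Real.rpow_sub hn0, Real.rpow_one]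
  gcongr

lemma ae_pi_forall_mem_support {X : Type u} [MetricSpace X] [MeasurableSpace X]
    [SecondCountableTopology X] {μ : Measure X} [IsProbabilityMeasure μ] (n : ℕ) :
    ∀ᵐ x ∂(Measure.pi fun _ : Fin n => μ), ∀ i, x i ∈ μ.support := by
  refine ae_all_iff.2 fun i => ?_
  exact (Measure.quasiMeasurePreserving_eval (fun _ : Fin n => μ) i).ae Measure.support_mem_ae

variable {X : Type u} [MetricSpace X] [MeasurableSpace X] [BorelSpace X]
  [SecondCountableTopology X] {μ : Measure X} [IsProbabilityMeasure μ]

lemma eventually_lintegral_wassersteinDist_le (hμ : Metric.ediam μ.support ≤ 1) {σ : ℝ}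
    (hσ : upperWassersteinDim μ < (σ : EReal)) :
    ∃ C : ℝ≥0, ∀ᶠ n : ℕ in atTop,
      ∫⁻ x, wassersteinDist μ (empiricalMeasure x) ∂(Measure.pi fun _ : Fin n => μ) ≤
        C * ENNReal.ofReal ((n : ℝ) ^ (-1 / σ)) := by
  obtain ⟨s, hs2, hsσ, hev⟩ := eventually_exists_cover hσ
  have hs0 : 0 < s := by linarith
  have hσ0 : 0 < σ := by linarith
  have hgap : 0 < 1 / s - 1 / σ := sub_pos.2 (one_div_lt_one_div_of_lt hs0 hsσ)
  -- Large enough that the step `η = 2 / (s ^ 2 K)` is at most the gap between `1 / s` and `1 / σ`.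
  obtain ⟨K, hK⟩ := exists_nat_gt (max 0 (2 / s ^ 2 / (1 / s - 1 / σ)))
  have hK0 : (0 : ℝ) < K := (le_max_left _ _).trans_lt hK
  set η : ℝ := 2 / s ^ 2 / K with hη
  have hη0 : 0 < η := by positivity
  have hηgap : η ≤ 1 / s - 1 / σ := by
    have := (le_max_right _ _).trans_lt hK
    rw [div_lt_iff₀ hgap] at this
    rw [hη, div_le_iff₀ hK0]
    linarith
  have hKη : K * η = 2 / s ^ 2 := by rw [hη]; field_simp
  let a : ℕ → ℝ := fun k => 1 / s - (min k K : ℕ) * η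
  have haK : ∀ k, 1 / s - 2 / s ^ 2 ≤ a k := fun k => by
    have : ((min k K : ℕ) : ℝ) * η ≤ K * η := by
      gcongr
      exact min_le_right _ _
    simp only [a]
    linarith
  have hbase : 0 < 1 / s - 2 / s ^ 2 := by
    have : 1 / s - 2 / s ^ 2 = (s - 2) / s ^ 2 := by field_simp
    rw [this]
    exact div_pos (by linarith) (by positivity)
  have has : ∀ k, a k ≤ 1 / s := fun k => by
    simp only [a]
    have : 0 ≤ ((min k K : ℕ) : ℝ) * η := by positivity
    linarith
  have hanti : ∀ k, a (k + 1) ≤ a k := fun k => by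
    have : ((min k K : ℕ) : ℝ) * η ≤ (min (k + 1) K : ℕ) * η := by
      gcongr
      omega
    simp only [a]
    linarith
  have hstep : ∀ k, k < K → a (k + 1) = a k - η := fun k hk => by
    have h1 : min (k + 1) K = k + 1 := min_eq_left hk
    have h2 : min k K = k := min_eq_left hk.le
    simp only [a, h1, h2]
    push_cast
    ring
  have haKK : a K = 1 / s - 2 / s ^ 2 := by simp [a, hKη]
  obtain ⟨ε₀, hε₀, hcov⟩ := mem_nhdsGT_iff_exists_Ioo_subset.1 hev
  have hlim : ∀ᶠ n : ℕ in atTop, (n : ℝ) ^ (-(1 / s - 2 / s ^ 2)) < ε₀ :=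
    ((tendsto_rpow_neg_atTop hbase).comp tendsto_natCast_atTop_atTop).eventually
      (gt_mem_nhds hε₀)
  -- In order: uncovered mass, finest scale, intermediate scales, leftover at the coarsest. The
  -- recursion `2 * R + 2 * ρ` for diameters is met by `4 ^ k` times the scale.
  refine ⟨2 * (K + 1) + 1 + ∑ k ∈ Finset.range K, 4 ^ (k + 1) + 1, ?_⟩
  filter_upwards [hlim, eventually_gt_atTop 0] with n hnε hn
  have hn0 : (0 : ℝ) < n := by exact_mod_cast hn
  have hn1 : (1 : ℝ) ≤ n := by exact_mod_cast hn
  have hεpos : ∀ k, 0 < (n : ℝ) ^ (-a k) := fun k => Real.rpow_pos_of_pos hn0 _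
  have hdata : ∀ k, ∃ A : Set X, MeasurableSet A ∧
      μ Aᶜ ≤ ENNReal.ofReal (((n : ℝ) ^ (-a k)) ^ (s / (s - 2))) ∧ ∃ N : ℕ, 0 < N ∧
      (N : ℝ) ≤ ((n : ℝ) ^ (-a k)) ^ (-s) ∧
      ∃ e : ℕ → X, ∀ x ∈ A, ∃ i < N, edist x (e i) ≤ ENNReal.ofReal ((n : ℝ) ^ (-a k) / 2) :=
    fun k => hcov ⟨hεpos k, lt_of_le_of_lt
      (Real.rpow_le_rpow_of_exponent_le hn1 (neg_le_neg (haK k))) hnε⟩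
  choose A hAm hAμ N hN hNle e he using hdata
  have hmain := lintegral_wassersteinDist_le_multiscale hμ hn K hAm
    (R := fun k => ENNReal.ofReal (4 ^ k * (n : ℝ) ^ (-a k))) hN he
    (by
      rw [← ENNReal.ofReal_ofNat, ← ENNReal.ofReal_mul (by norm_num)]
      refine ENNReal.ofReal_le_ofReal ?_
      linarith)
    (fun k => by
      have h1 := hεpos k
      have h2 := hεpos (k + 1)
      rw [← ENNReal.ofReal_ofNat, ← ENNReal.ofReal_mul (by norm_num),
        ← ENNReal.ofReal_mul (by norm_num), ← ENNReal.ofReal_add (by positivity) (by positivity)]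
      refine ENNReal.ofReal_le_ofReal ?_
      have h3 : (n : ℝ) ^ (-a k) ≤ (n : ℝ) ^ (-a (k + 1)) :=
        Real.rpow_le_rpow_of_exponent_le hn1 (neg_le_neg (hanti k))
      have h4 : (1 : ℝ) ≤ 4 ^ k := one_le_pow₀ (by norm_num)
      rw [pow_succ]
      nlinarith [mul_le_mul_of_nonneg_left h3 (by positivity : (0 : ℝ) ≤ 4 ^ k),
        mul_le_mul_of_nonneg_right h4 h2.le])
  set u : ℝ := (n : ℝ) ^ (-1 / σ) with hu
  have hmono : ∀ c : ℝ, c ≤ -1 / σ → (n : ℝ) ^ c ≤ u := fun c hc =>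
    Real.rpow_le_rpow_of_exponent_le hn1 hc
  have hσs : -(1 / s) ≤ -1 / σ := by
    have : -1 / σ = -(1 / σ) := by ring
    linarith
  have hσ' : -1 / σ = -(1 / σ) := by ring
  refine hmain.trans ?_
  push_cast
  rw [add_mul, add_mul, add_mul, one_mul]
  refine add_le_add (add_le_add (add_le_add ?_ ?_) ?_) ?_
  · rw [mul_assoc]
    gcongr
    calc ∑ k ∈ Finset.range (K + 1), μ (A k)ᶜ
        ≤ ∑ _k ∈ Finset.range (K + 1), ENNReal.ofReal u := by
          refine Finset.sum_le_sum fun k _ => (hAμ k).trans (ENNReal.ofReal_le_ofReal ?_)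
          rw [← Real.rpow_mul hn0.le]
          refine hmono _ (le_trans ?_ hσs)
          -- The coarsest scale is the worst for uncovered mass, and there the exponent is exactly
          -- `1 / s`.
          have h1 : (1 / s - 2 / s ^ 2) * (s / (s - 2)) = 1 / s := by
            have : s - 2 ≠ 0 := by linarith
            field_simp
          have h2 := mul_le_mul_of_nonneg_right (haK k)
            (div_nonneg hs0.le (by linarith) : 0 ≤ s / (s - 2))
          linarith
      _ = (K + 1) * ENNReal.ofReal u := by simp
  · refine ENNReal.ofReal_le_ofReal ?_
    rw [pow_zero, one_mul]
    refine hmono _ (le_trans (le_of_eq ?_) hσs)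
    simp [a]
  · rw [Finset.sum_mul]
    refine Finset.sum_le_sum fun k hk => ?_
    have hkK : k < K := Finset.mem_range.1 hk
    rw [← ENNReal.ofReal_mul (by positivity)]
    have h4 : (4 : ℝ≥0∞) ^ (k + 1) = ENNReal.ofReal (4 ^ (k + 1)) := by
      rw [ENNReal.ofReal_pow (by norm_num), ENNReal.ofReal_ofNat]
    rw [h4, ← ENNReal.ofReal_mul (by positivity)]
    refine ENNReal.ofReal_le_ofReal ?_
    rw [mul_assoc]
    gcongr
    calc (n : ℝ) ^ (-a (k + 1)) * Real.sqrt (N k / n)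
        ≤ (n : ℝ) ^ (-a (k + 1)) * (n : ℝ) ^ ((s * a k - 1) / 2) := by
          gcongr
          exact sqrt_div_le_rpow hn (hNle k)
      _ = (n : ℝ) ^ (-a (k + 1) + (s * a k - 1) / 2) := (Real.rpow_add hn0 _ _).symm
      _ ≤ u := hmono _ (by
          rw [hstep k hkK]
          have h1 : a k * (s / 2 - 1) ≤ 1 / s * (s / 2 - 1) :=
            mul_le_mul_of_nonneg_right (has k) (by linarith)
          have h2 : 1 / s * (s / 2 - 1) = 1 / 2 - 1 / s := by field_simp
          linarith)
  · refine ENNReal.ofReal_le_ofReal ((sqrt_div_le_rpow hn (hNle K)).trans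
      (hmono _ (le_trans (le_of_eq ?_) hσs)))
    rw [haKK]
    field_simp
    ring

lemma wassersteinDist_empiricalMeasure_le_one (hμ : Metric.ediam μ.support ≤ 1) {n : ℕ}
    (hn : 0 < n) {x : Fin n → X} (hx : ∀ i, x i ∈ μ.support) :
    wassersteinDist μ (empiricalMeasure x) ≤ 1 := by
  have := isProbabilityMeasure_empiricalMeasure hn x
  have hS : MeasurableSet μ.support := Measure.isClosed_support.measurableSet
  let b : X → ℝ≥0∞ := μ.supportᶜ.indicator fun _ => ⊤
  have hb : Measurable b := measurable_const.indicator hS.compl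
  refine (wassersteinDist_le_of_forall (r := 1) (by simp) hb fun y z => ?_).trans (le_of_eq ?_)
  · by_cases hy : y ∈ μ.support
    swap
    · simp [b, hy]
    by_cases hz : z ∈ μ.support
    swap
    · simp [b, hz]
    exact ((Metric.edist_le_ediam_of_mem hy hz).trans hμ).trans
      (by rw [add_assoc]; exact le_self_add)
  · rw [lintegral_empiricalMeasure _ hb]
    simp [b, lintegral_indicator_const hS.compl, hx]

/-- The expected empirical Wasserstein distance decays like `n ^ (-1 / σ)` for every `σ` above
the upper Wasserstein dimension. -/
lemma exists_lintegral_wassersteinDist_le (hμ : Metric.ediam μ.support ≤ 1) {σ : ℝ}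
    (hσ : upperWassersteinDim μ < (σ : EReal)) :
    ∃ lam : ℝ, 0 ≤ lam ∧ ∀ n : ℕ, 0 < n →
      ∫⁻ x, wassersteinDist μ (empiricalMeasure x) ∂(Measure.pi fun _ : Fin n => μ) ≤
        ENNReal.ofReal (lam * (n : ℝ) ^ (-1 / σ)) := by
  obtain ⟨C, hC⟩ := eventually_lintegral_wassersteinDist_le hμ hσ
  obtain ⟨n₀, hn₀⟩ := eventually_atTop.1 hC
  obtain ⟨s, hs2, hsσ, _⟩ := eventually_exists_cover hσ
  -- The second summand handles `n < n₀`, where the distance is almost surely at most `1`.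
  refine ⟨C + (n₀ : ℝ) ^ (1 / σ), by positivity, fun n hn => ?_⟩
  have hn0 : (0 : ℝ) < n := by exact_mod_cast hn
  rcases le_or_gt n₀ n with h | h
  · refine (hn₀ n h).trans ?_
    rw [← ENNReal.ofReal_coe_nnreal, ← ENNReal.ofReal_mul C.coe_nonneg]
    refine ENNReal.ofReal_le_ofReal ?_
    gcongr
    exact le_add_of_nonneg_right (by positivity)
  · have h1 : ∫⁻ x, wassersteinDist μ (empiricalMeasure x) ∂(Measure.pi fun _ : Fin n => μ) ≤
        ∫⁻ _, 1 ∂(Measure.pi fun _ : Fin n => μ) :=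
      lintegral_mono_ae ((ae_pi_forall_mem_support n).mono fun x hx =>
        wassersteinDist_empiricalMeasure_le_one hμ hn hx)
    refine h1.trans ?_
    simp only [lintegral_const, measure_univ, mul_one, ENNReal.one_le_ofReal]
    have h2 : (n : ℝ) ^ (1 / σ) ≤ (n₀ : ℝ) ^ (1 / σ) := by
      gcongr
      exact div_nonneg zero_le_one (by linarith)
    have h3 : (n : ℝ) ^ (1 / σ) * (n : ℝ) ^ (-1 / σ) = 1 := by
      rw [← Real.rpow_add hn0, neg_div, add_neg_cancel, Real.rpow_zero]
    calc (1 : ℝ) = (n : ℝ) ^ (1 / σ) * (n : ℝ) ^ (-1 / σ) := h3.symm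
      _ ≤ (n₀ : ℝ) ^ (1 / σ) * (n : ℝ) ^ (-1 / σ) := by gcongr
      _ ≤ _ := by
        gcongr
        exact le_add_of_nonneg_left C.2

lemma one_sub_exp_le_measureReal_wassersteinDist_le (hμ : Metric.ediam μ.support ≤ 1) {n : ℕ}
    (hn : 0 < n) {B : ℝ} (hB0 : 0 ≤ B)
    (hB : ∫⁻ x, wassersteinDist μ (empiricalMeasure x) ∂(Measure.pi fun _ : Fin n => μ) ≤
      ENNReal.ofReal B) {t : ℝ} (ht : 0 ≤ t) :
    1 - Real.exp (-2 * n * t ^ 2) ≤ (Measure.pi fun _ : Fin n => μ).real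
      {x | wassersteinDist μ (empiricalMeasure x) ≤ ENNReal.ofReal (B + t)} := by
  classical
  have hS : MeasurableSet μ.support := Measure.isClosed_support.measurableSet
  obtain ⟨x₀, hx₀⟩ : μ.support.Nonempty :=
    Measure.nonempty_support (IsProbabilityMeasure.ne_zero μ)
  -- McDiarmid needs its bounds at every sample, not almost every one. Retracting onto the support
  -- secures them and changes nothing almost surely.
  let r : X → X := fun x => if x ∈ μ.support then x else x₀
  have hr : Measurable r := Measurable.ite hS measurable_id measurable_const
  have hrS : ∀ x, r x ∈ μ.support := fun x => by
    by_cases h : x ∈ μ.support <;> simp [r, h, hx₀]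
  let F : (Fin n → X) → ℝ≥0∞ := fun x => wassersteinDist μ (empiricalMeasure fun i => r (x i))
  have hF1 : ∀ x, F x ≤ 1 := fun x =>
    wassersteinDist_empiricalMeasure_le_one hμ hn fun i => hrS _
  have hFtop : ∀ x, F x ≠ ⊤ := fun x => ne_top_of_le_ne_top ENNReal.one_ne_top (hF1 x)
  have hFm : Measurable F := (measurable_wassersteinDist_empiricalMeasure μ hn).comp
    (measurable_pi_lambda _ fun i => hr.comp (measurable_pi_apply i))
  have hFae : ∀ᵐ x ∂(Measure.pi fun _ : Fin n => μ),
      F x = wassersteinDist μ (empiricalMeasure x) :=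
    (ae_pi_forall_mem_support n).mono fun x hx => by
      have : (fun i => r (x i)) = x := funext fun i => if_pos (hx i)
      simp only [F, this]
  have hFupd : ∀ x y : Fin n → X, ∀ i, (∀ j ≠ i, x j = y j) →
      (F x).toReal ≤ (F y).toReal + (n : ℝ)⁻¹ := fun x y i hxy => by
    have h1 := wassersteinDist_le_add_sum_edist μ hn (fun j => r (x j)) (fun j => r (y j))
    have h2 : ∑ j, edist (r (x j)) (r (y j)) ≤ 1 := by
      rw [Finset.sum_eq_single i (fun j _ hj => by rw [hxy j hj, edist_self]) (by simp)]
      exact (Metric.edist_le_ediam_of_mem (hrS _) (hrS _)).trans hμ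
    have h3 : F x ≤ F y + (n : ℝ≥0∞)⁻¹ :=
      h1.trans (add_le_add le_rfl ((mul_le_mul_right h2 _).trans (mul_one _).le))
    have h4 : (n : ℝ≥0∞)⁻¹ ≠ ⊤ := ENNReal.inv_ne_top.2 (by simp [hn.ne'])
    have h5 := ENNReal.toReal_mono (ENNReal.add_ne_top.2 ⟨hFtop y, h4⟩) h3
    rwa [ENNReal.toReal_add (hFtop y) h4, ENNReal.toReal_inv, ENNReal.toReal_natCast] at h5
  have hmc := measureReal_pi_ge_le_exp (μ := μ) hn (g := fun x => (F x).toReal)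
    hFm.ennreal_toReal (M := 1) (fun x => by
      rw [abs_of_nonneg ENNReal.toReal_nonneg]
      exact ENNReal.toReal_le_of_le_ofReal zero_le_one (by simpa using hF1 x))
    (fun x i a => by
      have h1 := hFupd (Function.update x i a) x i fun j hj => Function.update_of_ne hj _ _
      have h2 := hFupd x (Function.update x i a) i fun j hj => (Function.update_of_ne hj _ _).symm
      rw [abs_le]
      constructor <;> linarith) ht
  have hmean : ∫ x, (F x).toReal ∂(Measure.pi fun _ : Fin n => μ) ≤ B := by
    rw [integral_toReal hFm.aemeasurable (ae_of_all _ fun x => (hFtop x).lt_top),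
      lintegral_congr_ae hFae]
    exact ENNReal.toReal_le_of_le_ofReal hB0 hB
  set G : Set (Fin n → X) :=
    {x | t ≤ (F x).toReal - ∫ y, (F y).toReal ∂(Measure.pi fun _ : Fin n => μ)} with hG
  have hGm : MeasurableSet G :=
    measurableSet_le measurable_const (hFm.ennreal_toReal.sub_const _)
  have hcompl : (Measure.pi fun _ : Fin n => μ).real Gᶜ = 1 -
      (Measure.pi fun _ : Fin n => μ).real G := probReal_compl_eq_one_sub hGm
  have hle : (Measure.pi fun _ : Fin n => μ).real Gᶜ ≤ (Measure.pi fun _ : Fin n => μ).real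
      {x | wassersteinDist μ (empiricalMeasure x) ≤ ENNReal.ofReal (B + t)} := by
    refine ENNReal.toReal_mono (measure_ne_top _ _) (measure_mono_ae ?_)
    filter_upwards [hFae] with x hx hxG
    have h1 : (F x).toReal < t + ∫ y, (F y).toReal ∂(Measure.pi fun _ : Fin n => μ) := by
      have : ¬ t ≤ (F x).toReal - _ := hxG
      linarith [not_le.1 this]
    change wassersteinDist μ (empiricalMeasure x) ≤ ENNReal.ofReal (B + t)
    rw [← hx, ← ENNReal.ofReal_toReal (hFtop x)]
    exact ENNReal.ofReal_le_ofReal (by linarith)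
  linarith

end Rate

/-! ### Finiteness of the distance -/

section Finiteness

variable {X : Type u} [MetricSpace X] [MeasurableSpace X]

lemma wassersteinDist_ne_top [BorelSpace X] [SecondCountableTopology X] {μ ν : Measure X}
    [IsProbabilityMeasure μ] [IsProbabilityMeasure ν] (hμ : Metric.ediam μ.support ≠ ⊤)
    (hν : Metric.ediam ν.support ≠ ⊤) : wassersteinDist μ ν ≠ ⊤ := by
  obtain ⟨x₀, hx₀⟩ : μ.support.Nonempty :=
    Measure.nonempty_support (IsProbabilityMeasure.ne_zero μ)
  obtain ⟨y₀, hy₀⟩ : ν.support.Nonempty :=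
    Measure.nonempty_support (IsProbabilityMeasure.ne_zero ν)
  have hb : (Metric.ediam μ.support + edist x₀ y₀ + Metric.ediam ν.support) ≠ ⊤ :=
    ENNReal.add_ne_top.2 ⟨ENNReal.add_ne_top.2 ⟨hμ, edist_ne_top _ _⟩, hν⟩
  refine ne_top_of_le_ne_top hb ?_
  have hγ : μ.prod ν ∈ couplings μ ν := by simpa using smul_prod_mem_couplings (p := μ) (q := ν)
  have h1 : ∀ᵐ z ∂μ.prod ν, z.1 ∈ μ.support :=
    Measure.quasiMeasurePreserving_fst.ae Measure.support_mem_ae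
  have h2 : ∀ᵐ z ∂μ.prod ν, z.2 ∈ ν.support :=
    Measure.quasiMeasurePreserving_snd.ae Measure.support_mem_ae
  refine (wassersteinDist_le_of_ae hγ (b := fun _ => 0) measurable_const ?_).trans
    (by simp only [measure_univ, mul_one, lintegral_zero, add_zero]; exact le_rfl)
  filter_upwards [h1, h2] with z hz1 hz2
  rw [add_zero, add_zero]
  refine (edist_triangle4 z.1 x₀ y₀ z.2).trans ?_
  gcongr
  · exact Metric.edist_le_ediam_of_mem hz1 hx₀
  · exact Metric.edist_le_ediam_of_mem hy₀ hz2

/-- Needed because `toReal` would send an infinite distance to `0`. -/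
lemma wassersteinDist_empiricalMeasure_ne_top {n m : ℕ} (hn : 0 < n) (hm : 0 < m)
    [BorelSpace X] [SecondCountableTopology X] (x : Fin n → X) (y : Fin m → X) :
    wassersteinDist (empiricalMeasure x) (empiricalMeasure y) ≠ ⊤ := by
  have hbdd : ∀ {k : ℕ} (z : Fin k → X), Metric.ediam (empiricalMeasure z).support ≠ ⊤ := by
    intro k z
    have hsub : (empiricalMeasure z).support ⊆ Set.range z :=
      Measure.support_subset_of_isClosed (Set.finite_range z).isClosed (by
        rw [mem_ae_iff, empiricalMeasure_apply _ (Set.finite_range z).measurableSet.compl]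
        simp)
    exact ((Set.finite_range z).isBounded.subset hsub).ediam_ne_top
  have := isProbabilityMeasure_empiricalMeasure hn x
  have := isProbabilityMeasure_empiricalMeasure hm y
  exact wassersteinDist_ne_top (hbdd x) (hbdd y)

end Finiteness

/-! ### From Wasserstein distance to coverage gap -/

section CoverageGap

/-- Markov's inequality with a correction: mass in `E` that travels less than `h` is compensated by
`φ` at its starting point. -/
lemma mul_measure_le_lintegral_edist_add {P Q : Measure ℝ} {γ : Measure (ℝ × ℝ)}
    (hγ : γ ∈ couplings P Q) {φ : ℝ → ℝ≥0∞} (hφ : Measurable φ) {E : Set (ℝ × ℝ)}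
    (hE : MeasurableSet E) {h : ℝ≥0∞} (hle : ∀ z ∈ E, h ≤ edist z.1 z.2 + φ z.1) :
    h * γ E ≤ ∫⁻ z, edist z.1 z.2 ∂γ + ∫⁻ x, φ x ∂P := by
  rw [← hγ.1, lintegral_map hφ measurable_fst, ← lintegral_add_left measurable_edist,
    ← lintegral_indicator_const hE]
  refine lintegral_mono fun z => ?_
  by_cases hz : z ∈ E
  · simpa [hz] using hle z hz
  · simp [hz]

lemma lintegral_le_of_density_le {P : Measure ℝ} {L : ℝ} (hP : HasLebesgueDensityBoundedBy P L)
    {φ : ℝ → ℝ≥0∞} (hφ : Measurable φ) :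
    ∫⁻ x, φ x ∂P ≤ ENNReal.ofReal L * ∫⁻ x, φ x := by
  obtain ⟨f, hf, hfL, rfl⟩ := hP
  rw [lintegral_withDensity_eq_lintegral_mul _ hf hφ, ← lintegral_const_mul _ hφ]
  refine lintegral_mono_ae (hfL.mono fun x hx => ?_)
  exact mul_le_mul_left hx _

lemma pos_of_hasLebesgueDensityBoundedBy {P : Measure ℝ} [IsProbabilityMeasure P] {L : ℝ}
    (hP : HasLebesgueDensityBoundedBy P L) : 0 < L := by
  by_contra hL
  have h := lintegral_le_of_density_le hP (φ := fun _ => 1) measurable_const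
  rw [ENNReal.ofReal_of_nonpos (not_lt.1 hL)] at h
  simp at h

lemma lintegral_ofReal_Ioc {f : ℝ → ℝ} (hf : Continuous f) {a b : ℝ} (hab : a ≤ b)
    (h0 : ∀ x ∈ Set.Ioc a b, 0 ≤ f x) :
    ∫⁻ x, (Set.Ioc a b).indicator (fun x => ENNReal.ofReal (f x)) x =
      ENNReal.ofReal (∫ x in a..b, f x) := by
  rw [lintegral_indicator measurableSet_Ioc, intervalIntegral.integral_of_le hab,
    ofReal_integral_eq_lintegral_ofReal]
  · exact (hf.integrableOn_Icc).mono_set Set.Ioc_subset_Icc_self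
  · exact (ae_restrict_iff' measurableSet_Ioc).2 (ae_of_all _ h0)

lemma le_sqrt_of_forall_mul_le {a w L : ℝ} (ha : 0 < a) (hL : 0 < L)
    (h : ∀ h : ℝ, 0 < h → h * a ≤ w + L * (h ^ 2 / 2)) : a ≤ Real.sqrt (2 * L * w) := by
  refine Real.le_sqrt_of_sq_le ?_
  -- The maximiser of `h * a - L * h ^ 2 / 2`.
  have h1 := h (a / L) (by positivity)
  have h2 : L * ((a / L) ^ 2 / 2) = a ^ 2 / L / 2 := by field_simp
  have h3 : a / L * a = a ^ 2 / L := by ring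
  rw [h2, h3] at h1
  have h4 : a ^ 2 / L ≤ 2 * w := by linarith
  rw [div_le_iff₀ hL] at h4
  linarith

/-- A bounded density turns Wasserstein closeness into Kolmogorov closeness. -/
lemma coverageGap_le_sqrt {P Q : Measure ℝ} [IsProbabilityMeasure P] [IsProbabilityMeasure Q]
    {L : ℝ} (hP : HasLebesgueDensityBoundedBy P L) (hW : wassersteinDist P Q ≠ ⊤) (τ : ℝ) :
    coverageGap P Q τ ≤ Real.sqrt (2 * L * (wassersteinDist P Q).toReal) := by
  have hL := pos_of_hasLebesgueDensityBoundedBy hP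
  have key : ∀ a : ℝ, (∀ h : ℝ, 0 < h → ∃ φ : ℝ → ℝ≥0∞, Measurable φ ∧
      ∫⁻ x, φ x = ENNReal.ofReal (h ^ 2 / 2) ∧ ∀ γ ∈ couplings P Q, ∃ E : Set (ℝ × ℝ),
        MeasurableSet E ∧ ENNReal.ofReal a ≤ γ E ∧
        ∀ z ∈ E, ENNReal.ofReal h ≤ edist z.1 z.2 + φ z.1) →
      a ≤ Real.sqrt (2 * L * (wassersteinDist P Q).toReal) := by
    intro a H
    rcases le_or_gt a 0 with ha | ha
    · exact ha.trans (Real.sqrt_nonneg _)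
    refine le_sqrt_of_forall_mul_le ha hL fun h hh => ?_
    obtain ⟨φ, hφ, hφint, hE⟩ := H h hh
    have hle : ENNReal.ofReal (h * a) ≤
        wassersteinDist P Q + ENNReal.ofReal (L * (h ^ 2 / 2)) := by
      rw [← tsub_le_iff_right]
      refine le_iInf₂ fun γ hγ => ?_
      rw [tsub_le_iff_right]
      obtain ⟨E, hEm, haE, hEle⟩ := hE γ hγ
      rw [ENNReal.ofReal_mul hh.le, ENNReal.ofReal_mul hL.le, ← hφint]
      calc ENNReal.ofReal h * ENNReal.ofReal a ≤ ENNReal.ofReal h * γ E := by gcongr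
        _ ≤ _ := mul_measure_le_lintegral_edist_add hγ hφ hEm hEle
        _ ≤ _ := by gcongr; exact lintegral_le_of_density_le hP hφ
    rw [← ENNReal.ofReal_toReal hW, ← ENNReal.ofReal_add ENNReal.toReal_nonneg (by positivity),
      ENNReal.ofReal_le_ofReal_iff (by positivity)] at hle
    exact hle
  have hcdf : ∀ γ ∈ couplings P Q, cdf P τ = γ.real (Prod.fst ⁻¹' Set.Iic τ) ∧
      cdf Q τ = γ.real (Prod.snd ⁻¹' Set.Iic τ) ∧ IsProbabilityMeasure γ := by
    intro γ hγ
    refine ⟨?_, ?_, ⟨?_⟩⟩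
    · rw [cdf_eq_real, ← hγ.1, map_measureReal_apply measurable_fst measurableSet_Iic]
    · rw [cdf_eq_real, ← hγ.2, map_measureReal_apply measurable_snd measurableSet_Iic]
    · have := measure_univ (μ := P)
      rwa [← hγ.1, Measure.map_apply measurable_fst MeasurableSet.univ] at this
  have hedist : ∀ x y d : ℝ, d ≤ |x - y| → ENNReal.ofReal d ≤ edist x y := fun x y d hd => by
    rw [edist_dist, Real.dist_eq]
    exact ENNReal.ofReal_le_ofReal hd
  have hsub : ∀ γ : Measure (ℝ × ℝ), IsProbabilityMeasure γ → ∀ A B : Set (ℝ × ℝ),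
      MeasurableSet B → ENNReal.ofReal (γ.real A - γ.real B) ≤ γ (A \ B) := by
    intro γ _ A B hB
    rw [ENNReal.ofReal_sub _ measureReal_nonneg, ofReal_measureReal (measure_ne_top _ _),
      ofReal_measureReal (measure_ne_top _ _)]
    exact le_measure_sdiff
  have hfst : MeasurableSet (Prod.fst ⁻¹' Set.Iic τ : Set (ℝ × ℝ)) :=
    measurable_fst measurableSet_Iic
  have hsnd : MeasurableSet (Prod.snd ⁻¹' Set.Iic τ : Set (ℝ × ℝ)) :=
    measurable_snd measurableSet_Iic
  rw [coverageGap, abs_sub_le_iff]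
  refine ⟨key _ fun h hh => ?_, key _ fun h hh => ?_⟩
  -- Mass with `x ≤ τ < y` travels at least `τ - x`; the ramp supplies exactly what is missing to
  -- `h`. The other sign of the gap uses the mirror-image ramp.
  · refine ⟨(Set.Ioc (τ - h) τ).indicator fun x => ENNReal.ofReal (x - (τ - h)), ?_, ?_, ?_⟩
    · exact (by fun_prop : Measurable fun x : ℝ => ENNReal.ofReal (x - (τ - h))).indicator
        measurableSet_Ioc
    · rw [lintegral_ofReal_Ioc (by fun_prop) (by linarith) fun x hx => by linarith [hx.1]]
      congr 1
      rw [intervalIntegral.integral_sub (by simp) (by simp), integral_id,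
        intervalIntegral.integral_const, smul_eq_mul]
      ring
    · intro γ hγ
      obtain ⟨h1, h2, h3⟩ := hcdf γ hγ
      refine ⟨_, hfst.diff hsnd, by rw [h1, h2]; exact hsub γ h3 _ _ hsnd, ?_⟩
      rintro ⟨x, y⟩ ⟨hx, hy⟩
      simp only [Set.mem_preimage, Set.mem_Iic, not_le] at hx hy
      have h4 : ENNReal.ofReal (τ - x) ≤ edist x y :=
        hedist _ _ _ (by rw [abs_sub_comm]; exact le_trans (by linarith) (le_abs_self _))
      by_cases hxh : τ - h < x
      · rw [Set.indicator_of_mem (show x ∈ Set.Ioc (τ - h) τ from ⟨hxh, hx⟩)]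
        refine le_trans (le_of_eq ?_) (add_le_add h4 le_rfl)
        rw [← ENNReal.ofReal_add (by linarith) (by linarith)]
        congr 1
        ring
      · exact ((ENNReal.ofReal_le_ofReal (by linarith)).trans h4).trans le_self_add
  · refine ⟨(Set.Ioc τ (τ + h)).indicator fun x => ENNReal.ofReal (τ + h - x), ?_, ?_, ?_⟩
    · exact (by fun_prop : Measurable fun x : ℝ => ENNReal.ofReal (τ + h - x)).indicator
        measurableSet_Ioc
    · rw [lintegral_ofReal_Ioc (by fun_prop) (by linarith) fun x hx => by linarith [hx.2]]
      congr 1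
      rw [intervalIntegral.integral_sub (by simp) (by simp), integral_id,
        intervalIntegral.integral_const, smul_eq_mul]
      ring
    · intro γ hγ
      obtain ⟨h1, h2, h3⟩ := hcdf γ hγ
      refine ⟨_, hsnd.diff hfst, by rw [h1, h2]; exact hsub γ h3 _ _ hfst, ?_⟩
      rintro ⟨x, y⟩ ⟨hy, hx⟩
      simp only [Set.mem_preimage, Set.mem_Iic, not_le] at hx hy
      have h4 : ENNReal.ofReal (x - τ) ≤ edist x y :=
        hedist _ _ _ (le_trans (by linarith) (le_abs_self _))
      by_cases hxh : x ≤ τ + h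
      · rw [Set.indicator_of_mem (show x ∈ Set.Ioc τ (τ + h) from ⟨hx, hxh⟩)]
        refine le_trans (le_of_eq ?_) (add_le_add h4 le_rfl)
        rw [← ENNReal.ofReal_add (by linarith) (by linarith)]
        congr 1
        ring
      · exact ((ENNReal.ofReal_le_ofReal (by linarith)).trans h4).trans le_self_add

end CoverageGap

/-! ### Combining the two samples -/

section MainBound

lemma IsIIDSample.map_eq_pi {Ω : Type v} [MeasurableSpace Ω] {S : Type u} [MeasurableSpace S]
    {P : Measure Ω} [IsProbabilityMeasure P] {μ : Measure S} {n : ℕ} {X : Fin n → Ω → S}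
    (hX : IsIIDSample P μ X) : P.map (fun ω i => X i ω) = Measure.pi fun _ => μ := by
  rw [(iIndepFun_iff_map_fun_eq_pi_map fun i => (hX.1 i).aemeasurable).1 hX.2.2]
  simp only [hX.2.1]

/-- With high probability the empirical distance controls the true one. -/
lemma exists_wassersteinDist_le_empirical {S : Type u} [MetricSpace S] [SecondCountableTopology S]
    [MeasurableSpace S] [BorelSpace S] {μ ν : Measure S} [IsProbabilityMeasure μ]
    [IsProbabilityMeasure ν] (hμ : Metric.ediam μ.support ≤ 1) (hν : Metric.ediam ν.support ≤ 1)
    {σμ σν : ℝ} (hσμ : upperWassersteinDim μ < (σμ : EReal))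
    (hσν : upperWassersteinDim ν < (σν : EReal)) :
    ∃ lamμ lamν : ℝ, ∀ (n m : ℕ), 0 < n → 0 < m → ∀ tμ tν : ℝ, 0 < tμ → 0 < tν →
      ∀ (Ω : Type v) [MeasurableSpace Ω] (P : Measure Ω) [IsProbabilityMeasure P]
        (X : Fin n → Ω → S) (Y : Fin m → Ω → S), AreIndepIIDSamples P μ ν X Y →
        (1 - Real.exp (-2 * n * tμ ^ 2)) * (1 - Real.exp (-2 * m * tν ^ 2)) ≤
          P.real {ω | (wassersteinDist μ ν).toReal ≤
            (wassersteinDist (empiricalMeasure fun i => X i ω)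
              (empiricalMeasure fun j => Y j ω)).toReal
            + lamμ * (n : ℝ) ^ (-1 / σμ) + lamν * (m : ℝ) ^ (-1 / σν) + tμ + tν} := by
  obtain ⟨lamμ, hlamμ, Hμ⟩ := exists_lintegral_wassersteinDist_le hμ hσμ
  obtain ⟨lamν, hlamν, Hν⟩ := exists_lintegral_wassersteinDist_le hν hσν
  refine ⟨lamμ, lamν, fun n m hn hm tμ tν htμ htν Ω _ P _ X Y ⟨hX, hY, hXY⟩ => ?_⟩
  set a : ℝ := lamμ * (n : ℝ) ^ (-1 / σμ) with ha
  set c : ℝ := lamν * (m : ℝ) ^ (-1 / σν) with hc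
  have ha0 : 0 ≤ a := by positivity
  have hc0 : 0 ≤ c := by positivity
  let A : Set (Fin n → S) :=
    {x | wassersteinDist μ (empiricalMeasure x) ≤ ENNReal.ofReal (a + tμ)}
  let B : Set (Fin m → S) :=
    {y | wassersteinDist ν (empiricalMeasure y) ≤ ENNReal.ofReal (c + tν)}
  have hA : MeasurableSet A :=
    measurableSet_le (measurable_wassersteinDist_empiricalMeasure μ hn) measurable_const
  have hB : MeasurableSet B :=
    measurableSet_le (measurable_wassersteinDist_empiricalMeasure ν hm) measurable_const
  have hXm : Measurable fun ω i => X i ω := measurable_pi_lambda _ hX.1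
  have hYm : Measurable fun ω j => Y j ω := measurable_pi_lambda _ hY.1
  have hPA : 1 - Real.exp (-2 * n * tμ ^ 2) ≤ P.real ((fun ω i => X i ω) ⁻¹' A) := by
    rw [← map_measureReal_apply hXm hA, hX.map_eq_pi]
    exact one_sub_exp_le_measureReal_wassersteinDist_le hμ hn ha0 (Hμ n hn) htμ.le
  have hPB : 1 - Real.exp (-2 * m * tν ^ 2) ≤ P.real ((fun ω j => Y j ω) ⁻¹' B) := by
    rw [← map_measureReal_apply hYm hB, hY.map_eq_pi]
    exact one_sub_exp_le_measureReal_wassersteinDist_le hν hm hc0 (Hν m hm) htν.le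
  have hB0 : 0 ≤ 1 - Real.exp (-2 * m * tν ^ 2) := by
    rw [sub_nonneg, Real.exp_le_one_iff]
    have : 0 ≤ (m : ℝ) * tν ^ 2 := by positivity
    linarith
  calc (1 - Real.exp (-2 * n * tμ ^ 2)) * (1 - Real.exp (-2 * m * tν ^ 2))
      ≤ P.real ((fun ω i => X i ω) ⁻¹' A) * P.real ((fun ω j => Y j ω) ⁻¹' B) :=
        mul_le_mul hPA hPB hB0 measureReal_nonneg
    _ = P.real ((fun ω i => X i ω) ⁻¹' A ∩ (fun ω j => Y j ω) ⁻¹' B) := by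
        simp only [measureReal_def]
        rw [hXY.measure_inter_preimage_eq_mul _ _ hA hB, ENNReal.toReal_mul]
    _ ≤ _ := by
        refine measureReal_mono fun ω hω => ?_
        obtain ⟨hωA, hωB⟩ := hω
        change wassersteinDist μ (empiricalMeasure fun i => X i ω) ≤ ENNReal.ofReal (a + tμ) at hωA
        change wassersteinDist ν (empiricalMeasure fun j => Y j ω) ≤ ENNReal.ofReal (c + tν) at hωB
        have := isProbabilityMeasure_empiricalMeasure hn fun i => X i ω
        have := isProbabilityMeasure_empiricalMeasure hm fun j => Y j ω
        obtain ⟨F, hF⟩ := exists_finset_empiricalMeasure_compl_eq_zero fun i => X i ω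
        obtain ⟨G, hG⟩ := exists_finset_empiricalMeasure_compl_eq_zero fun j => Y j ω
        have hfin := wassersteinDist_empiricalMeasure_ne_top hn hm
          (fun i => X i ω) (fun j => Y j ω)
        rw [wassersteinDist_comm] at hωB
        have hW : wassersteinDist μ ν ≤ ENNReal.ofReal (a + tμ) +
            (wassersteinDist (empiricalMeasure fun i => X i ω) (empiricalMeasure fun j => Y j ω) +
              ENNReal.ofReal (c + tν)) :=
          -- Both uses of the triangle inequality pass through a finitely supported empirical
          -- measure, never through `μ` or `ν`.
          (wassersteinDist_triangle hF).trans
            (add_le_add hωA ((wassersteinDist_triangle hG).trans (add_le_add le_rfl hωB)))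
        rw [← ENNReal.ofReal_toReal hfin, ← ENNReal.ofReal_add ENNReal.toReal_nonneg
          (by positivity), ← ENNReal.ofReal_add (by positivity) (by positivity)] at hW
        have := ENNReal.toReal_le_of_le_ofReal (by positivity) hW
        change (wassersteinDist μ ν).toReal ≤ _
        linarith

end MainBound

theorem theorem3 :
    -- the Wasserstein distance
    (∀ (S : Type u) [MetricSpace S] [SecondCountableTopology S] [MeasurableSpace S] [BorelSpace S]
      (μ ν : Measure S) [IsProbabilityMeasure μ] [IsProbabilityMeasure ν],
      Metric.ediam μ.support ≤ 1 → Metric.ediam ν.support ≤ 1 →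
      ∀ σμ σν : ℝ, upperWassersteinDim μ < (σμ : EReal) → upperWassersteinDim ν < (σν : EReal) →
      wassersteinDist μ ν ≠ ⊤ ∧
      ∃ lamμ lamν : ℝ, ∀ (n m : ℕ), 0 < n → 0 < m → ∀ tμ tν : ℝ, 0 < tμ → 0 < tν →
        ∀ (Ω : Type v) [MeasurableSpace Ω] (P : Measure Ω) [IsProbabilityMeasure P]
          (X : Fin n → Ω → S) (Y : Fin m → Ω → S), AreIndepIIDSamples P μ ν X Y →
          (1 - Real.exp (-2 * n * tμ ^ 2)) * (1 - Real.exp (-2 * m * tν ^ 2)) ≤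
            P.real {ω | (wassersteinDist μ ν).toReal ≤
              (wassersteinDist (empiricalMeasure fun i => X i ω)
                (empiricalMeasure fun j => Y j ω)).toReal
              + lamμ * (n : ℝ) ^ (-1 / σμ) + lamν * (m : ℝ) ^ (-1 / σν) + tμ + tν}) ∧
    -- the coverage gap, simultaneously at all thresholds
    (∀ (PV QV : Measure ℝ) [IsProbabilityMeasure PV] [IsProbabilityMeasure QV],
      Metric.ediam PV.support ≤ 1 → Metric.ediam QV.support ≤ 1 →
      ∀ L : ℝ, HasLebesgueDensityBoundedBy PV L →
      ∀ σP σQ : ℝ, upperWassersteinDim PV < (σP : EReal) → upperWassersteinDim QV < (σQ : EReal) →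
      ∃ lamP lamQ : ℝ, ∀ (n m : ℕ), 0 < n → 0 < m → ∀ tP tQ : ℝ, 0 < tP → 0 < tQ →
        ∀ (Ω : Type v) [MeasurableSpace Ω] (P : Measure Ω) [IsProbabilityMeasure P]
          (X : Fin n → Ω → ℝ) (Y : Fin m → Ω → ℝ), AreIndepIIDSamples P PV QV X Y →
          (1 - Real.exp (-2 * n * tP ^ 2)) * (1 - Real.exp (-2 * m * tQ ^ 2)) ≤
            P.real {ω | ∀ τ : ℝ, coverageGap PV QV τ ≤
              Real.sqrt (2 * L * ((wassersteinDist (empiricalMeasure fun i => X i ω)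
                (empiricalMeasure fun j => Y j ω)).toReal
              + lamP * (n : ℝ) ^ (-1 / σP) + lamQ * (m : ℝ) ^ (-1 / σQ) + tP + tQ))}) := by
  refine ⟨fun S _ _ _ _ μ ν _ _ hμ hν σμ σν hσμ hσν => ⟨?_, ?_⟩, ?_⟩
  · exact wassersteinDist_ne_top (ne_top_of_le_ne_top ENNReal.one_ne_top hμ)
      (ne_top_of_le_ne_top ENNReal.one_ne_top hν)
  · exact exists_wassersteinDist_le_empirical hμ hν hσμ hσν
  · intro PV QV _ _ hP hQ L hL σP σQ hσP hσQ
    obtain ⟨lamP, lamQ, H⟩ := exists_wassersteinDist_le_empirical.{0, v} hP hQ hσP hσQ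
    refine ⟨lamP, lamQ, fun n m hn hm tP tQ htP htQ Ω _ P _ X Y hXY => ?_⟩
    refine (H n m hn hm tP tQ htP htQ Ω P X Y hXY).trans (measureReal_mono fun ω hω τ => ?_)
    have hW : wassersteinDist PV QV ≠ ⊤ :=
      wassersteinDist_ne_top (ne_top_of_le_ne_top ENNReal.one_ne_top hP)
        (ne_top_of_le_ne_top ENNReal.one_ne_top hQ)
    have hL0 := pos_of_hasLebesgueDensityBoundedBy hL
    refine (coverageGap_le_sqrt hL hW τ).trans (Real.sqrt_le_sqrt ?_)
    exact mul_le_mul_of_nonneg_left hω (by positivity)
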